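/- Let $G$ be a torus with Lie algebra $\mathfrak g$ and integral lattice $\mathbb Z_G=\ker(\exp:\mathfrak g\to G)$, let $\rho:G\to\mathbb T^d=\mathbb R^d/\mathbb Z^d$ be a homomorphism of Lie groups, and let $w^\alpha=\rho^\vee(e^\alpha)\in\mathfrak g^\vee$ $(\alpha=1,\dots,d)$ be the differentials of its coordinates. Let $\mathbb T^d$ act on $\mathbb C^d$ by $[\theta]\cdot z=(e^{-2\pi i\theta_\alpha}z_\alpha)_\alpha$ and put $\mu:\mathbb C^d\to\mathfrak g^\vee$, $\mu(z)=\pi\sum_\alpha|z_\alpha|^2w^\alpha$. Let $\tau\in\mathfrak g^\vee$ be a regular value of $\mu$ and suppose that $\mu^{-1}(\tau)\neq\varnothing$ and that $\mu$ is proper. Denote by $\mathbb C^d/\!\!/_\tau G=[\mu^{-1}(\tau)/G]$ the quotient stack over the category of smooth manifolds; its objects are pairs of a smooth principal $G$-bundle $P\to U$ and a smooth equivariant map $P\to\mu^{-1}(\tau)$. Let $c_1,\dots,c_d\in\mathbb R$ satisfy $\sum_\alpha c_\alpha w^\alpha=\tau$. Let $\dot\rho:\mathbb Z_G\to\mathbb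 Z^d$ be induced by $\rho$, let $N=\operatorname{coker}\dot\rho$, let $\beta:\mathbb Z^d\to N$ be the projection, $\mathfrak t=N\otimes\mathbb R$, $\Lambda$ the image of $N$ in $\mathfrak t$, and $\bar n_\alpha\in\Lambda$ the image of $\beta(e_\alpha)$. Let $\sigma:\mathbb T^d\to T=\mathfrak t/\Lambda$ be the homomorphism induced by $\beta$. Put $$\Delta=\{\eta\in\mathfrak t^\vee:\langle\eta,\bar n_\alpha\rangle\ge -c_\alpha\ (\alpha=1,\dots,d)\},\qquad F_\alpha=\{\eta\in\Delta:\langle\eta,\bar n_\alpha\rangle=-c_\alpha\}.$$ 1. There is a homomorphism of tori $s:T\to\mathbb T^d$ with $\sigma\circ s=\mathrm{id}_T$, and for every such $s$ the image of the reduced moment map $\bar\mu:\mu^{-1}(\tau)\to\mathfrak t^\vee$, $\bar\mu(z)=\sum_\alpha(\pi|z_\alpha|^2-c_\alpha)s^\vee(e^\alpha)$, is $\Delta$. 2. $(N,\Delta,\beta)$ is a stacky polytope with list of facets $F_1,\dots,F_d$, some of which may be empty. That is: $N$ is finitely generated; $\Delta$ is a nonempty full-dimensional polytope; each $F_\alpha$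 is either empty or a facet of $\Delta$, and each facet of $\Delta$ equals $F_\alpha$ for exactly one $\alpha$; $\Delta$ is simple, i.e. every vertex lies in exactly $\operatorname{rank}N$ facets; whenever $F_\alpha\ne\varnothing$, $\bar n_\alpha\neq 0$ is an inward-pointing normal vector of $F_\alpha$; and $\operatorname{coker}\beta$ is finite. 3. Let $DG(\beta)=H^1(\operatorname{Cone}(\beta)^\vee)$ and $\beta^{DG}:(\mathbb Z^d)^\vee\to DG(\beta)$ be formed from any resolutions of $\mathbb Z^d$ and $N$ by free abelian groups of finite rank and any chain map between them lifting $\beta$. The stack $\mathcal X_{\vec\Delta}$ associated to $(N,\Delta,\beta)$ and the constants $c_\alpha$ is the symplectic quotient $\mathbb C^d/\!\!/_{\tau'}G'$, where $G'=\operatorname{Hom}_{\mathbb Z}(DG(\beta),\mathbb T)$, $\rho':G'\to\mathbb T^d$ is induced by $\beta^{DG}$, and $\tau'=\sum_\alpha c_\alpha(\rho')^\vee(e^\alpha)$. (The $c_\alpha$ with $F_\alpha\ne\varnothing$ are determined by $(N,\Delta,\beta)$ and the list of facets.) Then $(G',\rho',\tau')$ satisfies the same hypotheses as $(G,\rho,\tau)$.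 There is an isomorphism $DG(\beta)\cong\mathbb Z_G^\vee$ that identifies $\beta^{DG}$ with $\dot\rho^\vee$; the isomorphism $\Phi: G\cong G'$ of Lie groups that it induces, $\Phi(\exp\xi)(x)=\langle x,\xi\rangle\bmod\mathbb Z$, identifies $\rho$ with $\rho'$ and $\tau$ with $\tau'$; and there is an equivalence of stacks over the category of smooth manifolds $$\mathcal X_{\vec\Delta}\simeq\mathbb C^d/\!\!/_\tau G,$$ given by change of structure group along $\Phi$. -/

import Mathlib

open scoped Manifold ContDiff Topology
open Topology CategoryTheory

namespace ToricStack

noncomputable section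

section ExpCharts

variable {V : Type*} [NormedAddCommGroup V] [NormedSpace ℝ V]
  {H : Type*} [AddCommGroup H] [TopologicalSpace H] [IsTopologicalAddGroup H]

/-- The chart at `h` of a topological group `H` with exponential map `e : V → H`:
the inverse of `v ↦ h + e v` near `v = 0`. -/
def expChart {e : V →+ H} (he : IsLocalHomeomorph e) (h : H) : OpenPartialHomeomorph H V :=
  (Homeomorph.addLeft (-h)).toOpenPartialHomeomorph.trans (he.localInverseAt 0)

/-- The charts `expChart he h` for `h : H` form an atlas. -/
abbrev expChartedSpace {e : V →+ H} (he : IsLocalHomeomorph e) : ChartedSpace V H where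
  atlas := Set.range (expChart he)
  chartAt := expChart he
  mem_chart_source h := by
    have h0 : e 0 ∈ (he.localInverseAt 0).source := he.apply_self_mem_localInverseAt_source
    simpa [expChart] using h0
  chart_mem_atlas h := ⟨h, rfl⟩

theorem localInverse_exp_contDiffAt {e : V →+ H} (he : IsLocalHomeomorph e)
    {W : Type*} [NormedAddCommGroup W] [NormedSpace ℝ W] {ψ : W → V} {w : W} {n : ℕ∞ω}
    (hψ : ContDiffAt ℝ n ψ w) (a : H) (hw : a + e (ψ w) ∈ (he.localInverseAt 0).source) :
    ContDiffAt ℝ n (fun x => he.localInverseAt 0 (a + e (ψ x))) w := by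
  set L := he.localInverseAt 0 with hL
  set u := L (a + e (ψ w)) with hu
  have hue : e u = a + e (ψ w) := he.apply_localInverseAt_of_mem hw
  have hmem : u ∈ L.target := L.map_source hw
  have hcont : ContinuousAt (fun x => u + (ψ x - ψ w)) w := by
    have := hψ.continuousAt
    fun_prop
  have hev : ∀ᶠ x in 𝓝 w, u + (ψ x - ψ w) ∈ L.target :=
    hcont.eventually_mem (L.open_target.mem_nhds (by simpa using hmem))
  have hsm : ContDiffAt ℝ n (fun x => u + (ψ x - ψ w)) w :=
    contDiffAt_const.add (hψ.sub contDiffAt_const)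
  refine hsm.congr_of_eventuallyEq ?_
  filter_upwards [hev] with x hx
  have h1 : a + e (ψ x) = e (u + (ψ x - ψ w)) := by
    rw [map_add, map_sub, hue]; abel
  rw [h1]
  have := L.right_inv hx
  rwa [hL, he.localInverseAt_symm] at this

theorem expLieAddGroup {e : V →+ H} (he : IsLocalHomeomorph e) (n : ℕ∞ω) :
    let _ := expChartedSpace he
    LieAddGroup 𝓘(ℝ, V) n H := by
  let _ := expChartedSpace he
  have hsymm : ∀ (h : H) (v : V), (expChart he h).symm v = h + e v := by
    intro h v
    have : (expChart he h).symm v = - -h + e v := by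
      rw [← congrFun (he.localInverseAt_symm 0) v]; rfl
    rw [this, neg_neg]
  have happ : ∀ (h x : H), expChart he h x = he.localInverseAt 0 (-h + x) := by
    intro h x
    simp [expChart]
  have hself : ∀ (h : H), expChart he h h = 0 := by
    intro h
    have : he.localInverseAt 0 (e 0) = 0 := he.localInverseAt_apply_self
    rw [happ]; simpa using this
  have hman : IsManifold 𝓘(ℝ, V) n H := by
    apply isManifold_of_contDiffOn
    rintro _ _ ⟨h, rfl⟩ ⟨h', rfl⟩ v hv
    apply ContDiffAt.contDiffWithinAt
    have hv' : -h' + (h + e v) ∈ (he.localInverseAt 0).source := by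
      have := hv.1
      simp only [modelWithCornersSelf_coe_symm, Set.preimage_id] at this
      have h2 : (expChart he h).symm v ∈ (expChart he h').source := this.2
      rw [hsymm] at h2
      simpa [expChart] using h2
    have := localInverse_exp_contDiffAt he (n := n) (ψ := id) (w := v) contDiffAt_id (-h' + h)
      (by simpa [add_assoc] using hv')
    refine this.congr_of_eventuallyEq (Filter.Eventually.of_forall fun x => ?_)
    simp [hsymm, happ, add_assoc]
  have h0 : (0 : H) ∈ (he.localInverseAt 0).source := by
    have : e 0 ∈ (he.localInverseAt 0).source := he.apply_self_mem_localInverseAt_source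
    simpa using this
  have hadd : ContMDiff (𝓘(ℝ, V).prod 𝓘(ℝ, V)) 𝓘(ℝ, V) n fun p : H × H => p.1 + p.2 := by
    rintro ⟨x, y⟩
    rw [contMDiffAt_iff]
    refine ⟨continuous_add.continuousAt, ContDiffAt.contDiffWithinAt ?_⟩
    have := localInverse_exp_contDiffAt he (n := n) (ψ := fun p : V × V => p.1 + p.2)
      (w := (0, 0)) (contDiff_fst.add contDiff_snd).contDiffAt 0 (by simpa using h0)
    have hpt : (extChartAt (𝓘(ℝ, V).prod 𝓘(ℝ, V)) ((x, y) : H × H)) (x, y) = ((0, 0) : V × V) := by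
      have hx : (extChartAt 𝓘(ℝ, V) x) x = 0 := hself x
      have hy : (extChartAt 𝓘(ℝ, V) y) y = 0 := hself y
      simp only [extChartAt_prod, PartialEquiv.prod_coe, hx, hy]
    rw [hpt]
    refine this.congr_of_eventuallyEq (Filter.Eventually.of_forall fun p => ?_)
    have e1 : (extChartAt (𝓘(ℝ, V).prod 𝓘(ℝ, V)) ((x, y) : H × H)).symm p
        = (x + e p.1, y + e p.2) := by
      simp only [extChartAt_prod, PartialEquiv.prod_symm, PartialEquiv.prod_coe]
      exact Prod.ext (hsymm x p.1) (hsymm y p.2)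
    have e2 : ∀ z, (extChartAt 𝓘(ℝ, V) (x + y)) z = he.localInverseAt 0 (-(x + y) + z) :=
      fun z => happ (x + y) z
    simp only [Function.comp, e1, e2, map_add]
    congr 1
    abel
  have hneg : ContMDiff 𝓘(ℝ, V) 𝓘(ℝ, V) n fun x : H => -x := by
    intro x
    rw [contMDiffAt_iff]
    refine ⟨continuous_neg.continuousAt, ContDiffAt.contDiffWithinAt ?_⟩
    have := localInverse_exp_contDiffAt he (n := n) (ψ := fun p : V => -p)
      (w := 0) contDiff_neg.contDiffAt 0 (by simpa using h0)
    have hpt : (extChartAt 𝓘(ℝ, V) x) x = 0 := hself x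
    rw [hpt]
    refine this.congr_of_eventuallyEq (Filter.Eventually.of_forall fun p => ?_)
    have e1 : (extChartAt 𝓘(ℝ, V) x).symm p = x + e p := hsymm x p
    have e2 : ∀ z, (extChartAt 𝓘(ℝ, V) (-x)) z = he.localInverseAt 0 (-(-x) + z) :=
      fun z => happ (-x) z
    simp only [Function.comp, e1, e2, map_neg]
    congr 1
    abel
  exact { hman with contMDiff_add := hadd, contMDiff_neg := hneg }

end ExpCharts

/-! ### The compact abelian Lie group `Hom(A, 𝕋)` -/

/-- `Hom_ℤ(A, 𝕋)`, where `𝕋 = ℝ / ℤ`. -/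
def CharGroup (A : Type) [AddCommGroup A] : Type := A →+ UnitAddCircle

namespace CharGroup

variable (A : Type) [AddCommGroup A]

instance : AddCommGroup (CharGroup A) := inferInstanceAs (AddCommGroup (A →+ UnitAddCircle))

instance : FunLike (CharGroup A) A UnitAddCircle :=
  inferInstanceAs (FunLike (A →+ UnitAddCircle) A UnitAddCircle)

instance : AddMonoidHomClass (CharGroup A) A UnitAddCircle :=
  inferInstanceAs (AddMonoidHomClass (A →+ UnitAddCircle) A UnitAddCircle)

/-- Evaluation, as a homomorphism to the functions `A → 𝕋`. -/
def toFun : CharGroup A →+ (A → UnitAddCircle) where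
  toFun h := h
  map_zero' := rfl
  map_add' _ _ := rfl

/-- The topology of pointwise convergence. -/
instance : TopologicalSpace (CharGroup A) := TopologicalSpace.induced (toFun A) inferInstance

instance : IsTopologicalAddGroup (CharGroup A) := topologicalAddGroup_induced (toFun A)

variable {A}

theorem continuous_eval (a : A) : Continuous fun h : CharGroup A => h a :=
  (continuous_apply a).comp continuous_induced_dom

variable [Module.Finite ℤ A]

theorem exists_gens (A : Type) [AddCommGroup A] [Module.Finite ℤ A] :
    ∃ (m : ℕ) (p : (Fin m → ℤ) →ₗ[ℤ] A), Function.Surjective p := Module.Finite.exists_fin' ℤ A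

/-- Values on generators. -/
def evalGens {m : ℕ} (p : (Fin m → ℤ) →ₗ[ℤ] A) : (A →+ ℝ) →ₗ[ℝ] (Fin m → ℝ) where
  toFun f i := f (p (Pi.single i 1))
  map_add' _ _ := rfl
  map_smul' _ _ := rfl

theorem hom_eq_of_gens {B : Type*} [AddCommGroup B] {m : ℕ} {p : (Fin m → ℤ) →ₗ[ℤ] A}
    (hp : Function.Surjective p) {f g : A →+ B}
    (h : ∀ i, f (p (Pi.single i 1)) = g (p (Pi.single i 1))) : f = g := by
  have : f.toIntLinearMap ∘ₗ p = g.toIntLinearMap ∘ₗ p := by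
    apply LinearMap.pi_ext'
    intro i
    ext
    simpa using h i
  ext a
  obtain ⟨c, rfl⟩ := hp a
  exact LinearMap.congr_fun this c

theorem evalGens_injective {m : ℕ} {p : (Fin m → ℤ) →ₗ[ℤ] A} (hp : Function.Surjective p) :
    Function.Injective (evalGens p) :=
  fun _ _ h => hom_eq_of_gens hp fun i => congrFun h i

instance : FiniteDimensional ℝ (A →+ ℝ) := by
  obtain ⟨m, p, hp⟩ := exists_gens A
  exact Module.Finite.of_injective (evalGens p) (evalGens_injective hp)

variable (A)

/-- The model space `ℝⁿ`, `n = dim Hom(A, ℝ)`, of `Hom(A, 𝕋)`. -/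
abbrev Model : Type := EuclideanSpace ℝ (Fin (Module.finrank ℝ (A →+ ℝ)))

/-- A linear isomorphism of the model space with `Hom(A, ℝ)`, the Lie algebra of `Hom(A, 𝕋)`. -/
def coords : Model A ≃ₗ[ℝ] (A →+ ℝ) := LinearEquiv.ofFinrankEq _ _ (by simp)

/-- The exponential map `Hom(A, ℝ) → Hom(A, 𝕋)`: reduction modulo `ℤ`. -/
def exp : Model A →+ CharGroup A where
  toFun x := (QuotientAddGroup.mk' (AddSubgroup.zmultiples (1 : ℝ))).comp (coords A x)
  map_zero' := by rw [map_zero, AddMonoidHom.comp_zero]; rfl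
  map_add' x y := by rw [map_add, AddMonoidHom.comp_add]; rfl

theorem exp_apply (x : Model A) (a : A) : exp A x a = ((coords A x a : ℝ) : UnitAddCircle) := rfl

theorem exp_continuous : Continuous (exp A) := by
  refine continuous_induced_rng.2 (continuous_pi fun a => ?_)
  change Continuous fun x => ((coords A x a : ℝ) : UnitAddCircle)
  have : Continuous fun x => coords A x a := by
    let ev : (A →+ ℝ) →ₗ[ℝ] ℝ := ⟨⟨fun f => f a, fun _ _ => rfl⟩, fun _ _ => rfl⟩
    exact LinearMap.continuous_of_finiteDimensional (ev ∘ₗ (coords A).toLinearMap)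
  exact (AddCircle.continuous_mk' (1 : ℝ)).comp this

/-- Small real lift of a point of the circle. -/
theorem exists_lift (t : UnitAddCircle) : ∃ x : ℝ, (x : UnitAddCircle) = t ∧ |x| = ‖t‖ := by
  obtain ⟨y, rfl⟩ := QuotientAddGroup.mk_surjective t
  refine ⟨y - round y, ?_, (UnitAddCircle.norm_eq (x := y)).symm⟩
  have : ((round y : ℝ) : UnitAddCircle) = 0 := by
    rw [AddCircle.coe_eq_zero_iff]; exact ⟨round y, by simp⟩
  rw [AddCircle.coe_sub, this, sub_zero]

/-- An integer multiple of `1` that is small is zero. -/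
theorem eq_zero_of_coe_eq_zero {x : ℝ} (h : (x : UnitAddCircle) = 0) (hx : |x| < 1) : x = 0 := by
  obtain ⟨n, rfl⟩ := (AddCircle.coe_eq_zero_iff (1 : ℝ)).1 h
  have : |n| < 1 := by
    have h1 : |(n : ℝ)| < 1 := by simpa using hx
    exact_mod_cast h1
  simp [Int.abs_lt_one_iff.1 this]

/-- Characters close to `0` on generators lift to small real-valued homomorphisms. -/
theorem exists_small_lift {m : ℕ} {p : (Fin m → ℤ) →ₗ[ℤ] A} (hp : Function.Surjective p) :
    ∃ δ > 0, ∀ h : CharGroup A, (∀ i, ‖h (p (Pi.single i 1))‖ < δ) →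
      ∃ x : Model A, exp A x = h ∧
        ∀ i, |coords A x (p (Pi.single i 1))| = ‖h (p (Pi.single i 1))‖ := by
  obtain ⟨S, hS⟩ := (IsNoetherian.noetherian (LinearMap.ker p) : (LinearMap.ker p).FG)
  set K : ℝ := ∑ c ∈ S, ∑ i, |(c i : ℝ)| with hK
  have hK0 : 0 ≤ K := by positivity
  refine ⟨1 / (K + 1), by positivity, fun h hh => ?_⟩
  choose x hx1 hx2 using fun i => exists_lift (h (p (Pi.single i 1)))
  let X : (Fin m → ℤ) →ₗ[ℤ] ℝ := Fintype.linearCombination ℤ x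
  have hX : ∀ c, X c = ∑ i, (c i : ℝ) * x i := by
    intro c; simp [X, Fintype.linearCombination_apply]
  have hred : ∀ c, ((X c : ℝ) : UnitAddCircle) = h (p c) := by
    have key : (QuotientAddGroup.mk' (AddSubgroup.zmultiples (1 : ℝ))).toIntLinearMap ∘ₗ X
        = (AddMonoidHom.toIntLinearMap (h : A →+ UnitAddCircle)) ∘ₗ p := by
      apply LinearMap.pi_ext'
      intro i
      ext
      have hXi : X (Pi.single i 1) = x i := by
        simp [X]
      change ((X (Pi.single i 1) : ℝ) : UnitAddCircle) = h (p (Pi.single i 1))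
      rw [hXi, hx1]
    exact fun c => LinearMap.congr_fun key c
  have hker : LinearMap.ker p ≤ LinearMap.ker X := by
    rw [← hS, Submodule.span_le]
    intro c hc
    have hpc : p c = 0 := by
      have : c ∈ LinearMap.ker p := hS ▸ Submodule.subset_span hc
      exact this
    change X c = 0
    apply eq_zero_of_coe_eq_zero
    · rw [hred, hpc]; exact map_zero h
    · have hcK : ∑ i, |(c i : ℝ)| ≤ K :=
        Finset.single_le_sum (f := fun c : Fin m → ℤ => ∑ i, |(c i : ℝ)|)
          (fun _ _ => by positivity) hc
      calc |X c| ≤ ∑ i, |(c i : ℝ) * x i| := by rw [hX]; exact Finset.abs_sum_le_sum_abs _ _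
        _ ≤ ∑ i, |(c i : ℝ)| * (1 / (K + 1)) := by
            refine Finset.sum_le_sum fun i _ => ?_
            rw [abs_mul]
            exact mul_le_mul_of_nonneg_left ((hx2 i).le.trans (hh i).le) (abs_nonneg _)
        _ = (∑ i, |(c i : ℝ)|) * (1 / (K + 1)) := by rw [Finset.sum_mul]
        _ ≤ K * (1 / (K + 1)) := by gcongr
        _ < 1 := by rw [mul_one_div, div_lt_one (by positivity)]; linarith
  let f : A →ₗ[ℤ] ℝ := (LinearMap.ker p).liftQ X hker ∘ₗ
    (p.quotKerEquivOfSurjective hp).symm.toLinearMap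
  have hf : ∀ c, f (p c) = X c := by
    intro c
    have : (p.quotKerEquivOfSurjective hp).symm (p c) = (LinearMap.ker p).mkQ c := by
      rw [LinearEquiv.symm_apply_eq]; rfl
    simp only [f, LinearMap.comp_apply, LinearEquiv.coe_coe, this]
    rfl
  have hfx : ∀ i, f (p (Pi.single i 1)) = x i := by
    intro i; rw [hf]; simp [X]
  have hc : coords A ((coords A).symm f.toAddMonoidHom) = f.toAddMonoidHom :=
    (coords A).apply_symm_apply _
  refine ⟨(coords A).symm f.toAddMonoidHom, ?_, fun i => ?_⟩
  · refine hom_eq_of_gens (B := UnitAddCircle) hp fun i => ?_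
    change ((coords A ((coords A).symm f.toAddMonoidHom) _ : ℝ) : UnitAddCircle) = _
    rw [hc]
    change ((f _ : ℝ) : UnitAddCircle) = _
    rw [hfx, hx1]
    rfl
  · rw [hc]
    change |f _| = _
    rw [hfx, hx2]

theorem gens_isEmbedding {m : ℕ} {p : (Fin m → ℤ) →ₗ[ℤ] A} (hp : Function.Surjective p) :
    IsEmbedding (fun (x : Model A) (i : Fin m) => coords A x (p (Pi.single i 1))) := by
  have : Function.Injective (evalGens p ∘ₗ (coords A).toLinearMap) :=
    (evalGens_injective hp).comp (coords A).injective
  exact (LinearMap.isClosedEmbedding_of_injective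
    (LinearMap.ker_eq_bot.2 this)).isEmbedding

theorem exp_isLocalHomeomorph : IsLocalHomeomorph (exp A) := by
  obtain ⟨m, p, hp⟩ := exists_gens A
  obtain ⟨δ, hδ, hlift⟩ := exists_small_lift A hp
  have hemb := gens_isEmbedding A hp
  have hopen : IsOpenMap (exp A) := by
    rw [IsTopologicalAddGroup.isOpenMap_iff_nhds_zero]
    intro U hU
    rw [Filter.mem_map, hemb.nhds_eq_comap] at hU
    obtain ⟨W, hW, hWU⟩ := hU
    rw [Metric.mem_nhds_iff] at hW
    obtain ⟨ε, hε, hεW⟩ := hW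
    have hnb : ∀ i, ∀ᶠ h : CharGroup A in 𝓝 0, ‖h (p (Pi.single i 1))‖ < min δ ε := by
      intro i
      have hc : ContinuousAt (fun h : CharGroup A => ‖h (p (Pi.single i 1))‖) 0 :=
        (continuous_norm.comp (continuous_eval _)).continuousAt
      refine hc.eventually_lt continuousAt_const ?_
      have : (0 : CharGroup A) (p (Pi.single i 1)) = 0 := rfl
      rw [this, norm_zero]; positivity
    filter_upwards [Filter.eventually_all.2 hnb] with h hh
    obtain ⟨x, hx, hx2⟩ := hlift h fun i => (hh i).trans_le (min_le_left _ _)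
    rw [← hx]
    apply hWU
    apply hεW
    rw [Metric.mem_ball, dist_pi_lt_iff hε]
    intro i
    have h0 : coords A 0 (p (Pi.single i 1)) = 0 := by rw [map_zero]; rfl
    rw [h0, Real.dist_eq, sub_zero, hx2]
    exact (hh i).trans_le (min_le_right _ _)
  rw [isLocalHomeomorph_iff_isOpenEmbedding_restrict]
  intro x
  let U : Set (Model A) := (fun (y : Model A) (i : Fin m) => coords A y (p (Pi.single i 1))) ⁻¹'
    Metric.ball (fun i => coords A x (p (Pi.single i 1))) (1 / 2)
  have hUo : IsOpen U := Metric.isOpen_ball.preimage hemb.continuous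
  have hxU : x ∈ U := Metric.mem_ball_self (by norm_num)
  refine ⟨U, hUo.mem_nhds hxU, ?_⟩
  refine IsOpenEmbedding.of_continuous_injective_isOpenMap
    ((exp_continuous A).comp continuous_subtype_val) ?_ (hopen.comp hUo.isOpenMap_subtype_val)
  rintro ⟨y, hy⟩ ⟨z, hz⟩ hyz
  change exp A y = exp A z at hyz
  apply Subtype.ext
  apply hemb.injective
  funext i
  have h1 := (dist_pi_lt_iff (by norm_num)).1 hy i
  have h2 := (dist_pi_lt_iff (by norm_num)).1 hz i
  rw [Real.dist_eq] at h1 h2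
  have h3 : ((coords A y (p (Pi.single i 1)) : ℝ) : UnitAddCircle)
      = ((coords A z (p (Pi.single i 1)) : ℝ) : UnitAddCircle) :=
    DFunLike.congr_fun hyz (p (Pi.single i 1))
  rw [← sub_eq_zero]
  apply eq_zero_of_coe_eq_zero
  · rw [AddCircle.coe_sub, h3, sub_self]
  · rw [abs_lt] at h1 h2 ⊢
    constructor <;> linarith [h1.1, h1.2, h2.1, h2.2]

/-- The smooth structure on `Hom(A, 𝕋)`, with charts the local inverses of the exponential map. -/
instance : ChartedSpace (Model A) (CharGroup A) := expChartedSpace (exp_isLocalHomeomorph A)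

instance : LieAddGroup 𝓘(ℝ, Model A) ∞ (CharGroup A) :=
  expLieAddGroup (exp_isLocalHomeomorph A) ∞

end CharGroup

/-! ### Lie algebra, exponential map and integral lattice of an abelian Lie group

For a Lie group `G` modelled on `E`, Mathlib's tangent space `T₀G` is `E`, so that `E` is the
Lie algebra of `G` and `E →L[ℝ] ℝ` is its dual. -/

section LieData

variable {E : Type} [NormedAddCommGroup E] [NormedSpace ℝ E]
  {G : Type} [AddCommGroup G] [TopologicalSpace G] [ChartedSpace E G]

/-- `G` is a torus: isomorphic, as a Lie group, to the quotient of its Lie algebra by the lattice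
spanned by a basis, i.e. to `ℝᵏ / ℤᵏ`. -/
def IsTorus (E : Type) [NormedAddCommGroup E] [NormedSpace ℝ E]
    (G : Type) [AddCommGroup G] [TopologicalSpace G] [ChartedSpace E G] : Prop :=
  ∃ (k : ℕ) (b : Module.Basis (Fin k) ℝ E) (p : E →+ G),
    Function.Surjective p ∧ IsLocalDiffeomorph 𝓘(ℝ, E) 𝓘(ℝ, E) ∞ p ∧
      (p.ker : Set E) = Submodule.span ℤ (Set.range b)

variable (E) in
/-- The initial velocity, in `T₀G`, of a one-parameter subgroup. -/
def velocity (γ : ℝ →+ G) : E := mfderiv 𝓘(ℝ, ℝ) 𝓘(ℝ, E) γ 0 (1 : ℝ)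

/-- `exp ξ = g`: the one-parameter subgroup with initial velocity `ξ` takes the value `g` at
time `1`. -/
def IsExp (ξ : E) (g : G) : Prop :=
  ∃ γ : ℝ →+ G, ContMDiff 𝓘(ℝ, ℝ) 𝓘(ℝ, E) ∞ γ ∧ velocity E γ = ξ ∧ γ 1 = g

theorem velocity_zero : velocity E (0 : ℝ →+ G) = 0 := by
  have : mfderiv 𝓘(ℝ, ℝ) 𝓘(ℝ, E) (fun _ : ℝ => (0 : G)) 0 = 0 := mfderiv_const
  exact DFunLike.congr_fun this (1 : ℝ)

theorem velocity_add [LieAddGroup 𝓘(ℝ, E) ∞ G] (γ δ : ℝ →+ G)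
    (hγ : ContMDiff 𝓘(ℝ, ℝ) 𝓘(ℝ, E) ∞ γ) (hδ : ContMDiff 𝓘(ℝ, ℝ) 𝓘(ℝ, E) ∞ δ) :
    velocity E (γ + δ) = velocity E γ + velocity E δ := by
  have hadd : MDifferentiableAt (𝓘(ℝ, ℝ).prod 𝓘(ℝ, ℝ)) 𝓘(ℝ, E)
      (fun p : ℝ × ℝ => γ p.1 + δ p.2) ((0 : ℝ), (0 : ℝ)) :=
    ((hγ.comp contMDiff_fst).add (hδ.comp contMDiff_snd)).mdifferentiableAt (by simp)
  have hdiag : MDifferentiableAt 𝓘(ℝ, ℝ) (𝓘(ℝ, ℝ).prod 𝓘(ℝ, ℝ))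
      (fun t : ℝ => ((t, t) : ℝ × ℝ)) 0 :=
    mdifferentiableAt_id.prodMk mdifferentiableAt_id
  have h1 : mfderiv 𝓘(ℝ, ℝ) 𝓘(ℝ, E) (fun t : ℝ => γ t + δ t) 0 (1 : ℝ)
      = mfderiv (𝓘(ℝ, ℝ).prod 𝓘(ℝ, ℝ)) 𝓘(ℝ, E) (fun p : ℝ × ℝ => γ p.1 + δ p.2)
        ((0 : ℝ), (0 : ℝ)) (mfderiv 𝓘(ℝ, ℝ) (𝓘(ℝ, ℝ).prod 𝓘(ℝ, ℝ))
          (fun t : ℝ => ((t, t) : ℝ × ℝ)) 0 (1 : ℝ)) :=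
    DFunLike.congr_fun (mfderiv_comp (f := fun t : ℝ => ((t, t) : ℝ × ℝ))
      (g := fun p : ℝ × ℝ => γ p.1 + δ p.2) (0 : ℝ) hadd hdiag) (1 : ℝ)
  have h3 : mfderiv 𝓘(ℝ, ℝ) (𝓘(ℝ, ℝ).prod 𝓘(ℝ, ℝ)) (fun t : ℝ => ((t, t) : ℝ × ℝ)) 0 (1 : ℝ)
      = ((1 : ℝ), (1 : ℝ)) := by
    have := mfderiv_prodMk (I := 𝓘(ℝ, ℝ)) (I' := 𝓘(ℝ, ℝ)) (I'' := 𝓘(ℝ, ℝ)) (x := (0 : ℝ))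
      (f := fun t : ℝ => t) (g := fun t : ℝ => t) mdifferentiableAt_id mdifferentiableAt_id
    rw [this]
    have h := mfderiv_id (I := 𝓘(ℝ, ℝ)) (x := (0 : ℝ))
    exact congrArg₂ Prod.mk (DFunLike.congr_fun h (1 : ℝ)) (DFunLike.congr_fun h (1 : ℝ))
  rw [h3] at h1
  have h2 := mfderiv_prod_eq_add_apply (v := ((1 : ℝ), (1 : ℝ))) hadd
  have e1 : (fun z : ℝ => γ z + δ 0) = γ := by funext z; simp
  have e2 : (fun z : ℝ => γ 0 + δ z) = δ := by funext z; simp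
  have h4 := h1.trans h2
  have h5 : (mfderiv 𝓘(ℝ, ℝ) 𝓘(ℝ, E) (fun z : ℝ => γ z + δ 0) 0 (1 : ℝ) : E) = velocity E γ := by
    rw [e1]; rfl
  have h6 : (mfderiv 𝓘(ℝ, ℝ) 𝓘(ℝ, E) (fun z : ℝ => γ 0 + δ z) 0 (1 : ℝ) : E) = velocity E δ := by
    rw [e2]; rfl
  rw [← h5, ← h6]
  exact h4

variable (E G) in
/-- The integral lattice `ℤ_G = ker (exp : Lie G → G)`. -/
def expKer [LieAddGroup 𝓘(ℝ, E) ∞ G] : AddSubgroup E where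
  carrier := {ξ | IsExp ξ (0 : G)}
  zero_mem' := ⟨0, contMDiff_const, velocity_zero, rfl⟩
  add_mem' := by
    rintro _ _ ⟨γ, hγ, rfl, h1⟩ ⟨δ, hδ, rfl, h2⟩
    exact ⟨γ + δ, hγ.add hδ, velocity_add γ δ hγ hδ, by simp [h1, h2]⟩
  neg_mem' := by
    rintro _ ⟨γ, hγ, rfl, h1⟩
    have hn : ContMDiff 𝓘(ℝ, ℝ) 𝓘(ℝ, E) ∞ (-γ) := hγ.neg
    refine ⟨-γ, hn, ?_, by simp [h1]⟩
    have := velocity_add γ (-γ) hγ hn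
    rw [add_neg_cancel, velocity_zero] at this
    exact eq_neg_of_add_eq_zero_right this.symm

/-- The circle-valued character `z ↦ e^{2πi ρ_α}` attached to a coordinate of `ρ : G → 𝕋^d`. -/
def charFun {d : ℕ} (ρ : G →ₜ+ (Fin d → UnitAddCircle)) (α : Fin d) (g : G) : ℂ :=
  ((ρ g α).toCircle : ℂ)

/-- The differential of `charFun ρ α` at `0`. -/
def dChar {d : ℕ} (ρ : G →ₜ+ (Fin d → UnitAddCircle)) (α : Fin d) : E →L[ℝ] ℂ :=
  mfderiv 𝓘(ℝ, E) 𝓘(ℝ, ℂ) (charFun ρ α) 0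

/-- The weight `w^α = ρ^∨(e^α) ∈ (Lie G)^∨`: the differential at `0` of the `α`-th coordinate
`ρ_α : G → ℝ / ℤ`, computed as `(1 / 2πi) d(e^{2πi ρ_α})`. -/
def weight {d : ℕ} (ρ : G →ₜ+ (Fin d → UnitAddCircle)) (α : Fin d) : E →L[ℝ] ℝ :=
  (2 * Real.pi)⁻¹ • Complex.imCLM.comp (dChar ρ α)

theorem weight_apply {d : ℕ} (ρ : G →ₜ+ (Fin d → UnitAddCircle)) (α : Fin d) (ξ : E) :
    weight ρ α ξ = (2 * Real.pi)⁻¹ * (dChar ρ α ξ).im := rfl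

theorem hom_eq_exp {f : ℝ → ℂ} {c : ℂ} (h0 : f 0 = 1) (hf : ∀ s t, f (s + t) = f s * f t)
    (hd : HasDerivAt f c 0) (t : ℝ) : f t = Complex.exp (c * t) := by
  have hft : ∀ t, HasDerivAt f (f t * c) t := by
    intro t
    have h1 : HasDerivAt (fun s => f t * f (s - t)) (f t * c) t := by
      have h2 : HasDerivAt (fun s : ℝ => f (s - t)) c t := by
        have h3 : HasDerivAt f c (t - t) := by simpa using hd
        simpa using h3.comp_sub_const t t
      exact h2.const_mul _
    refine h1.congr_of_eventuallyEq (Filter.Eventually.of_forall fun s => ?_)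
    change f s = f t * f (s - t)
    rw [← hf]; congr 1; ring
  have hE : ∀ t : ℝ, HasDerivAt (fun t : ℝ => Complex.exp (-(c * t)))
      (Complex.exp (-(c * t)) * (-c)) t := by
    intro t
    have h1 : HasDerivAt (fun t : ℝ => -(c * (t : ℂ))) (-c) t := by
      simpa using ((Complex.ofRealCLM.hasDerivAt (x := t)).const_mul c).fun_neg
    exact h1.cexp
  have hconst : ∀ t, f t * Complex.exp (-(c * t)) = f 0 * Complex.exp (-(c * (0 : ℝ))) := by
    intro t
    refine is_const_of_deriv_eq_zero (f := fun t : ℝ => f t * Complex.exp (-(c * t)))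
      (fun t => ((hft t).fun_mul (hE t)).differentiableAt) (fun t => ?_) t 0
    rw [((hft t).fun_mul (hE t)).deriv]; ring
  have := hconst t
  rw [h0, Complex.exp_neg] at this
  have hne := Complex.exp_ne_zero (c * t)
  field_simp at this
  simpa using this

theorem weight_int [LieAddGroup 𝓘(ℝ, E) ∞ G] {d : ℕ} (ρ : G →ₜ+ (Fin d → UnitAddCircle))
    (α : Fin d) (ξ : expKer E G) : ∃ n : ℤ, weight ρ α (ξ : E) = n := by
  obtain ⟨ξ, γ, hγ, rfl, h1⟩ := ξ
  by_cases hχ : MDifferentiableAt 𝓘(ℝ, E) 𝓘(ℝ, ℂ) (charFun ρ α) 0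
  swap
  · refine ⟨0, ?_⟩
    have : (dChar ρ α : E →L[ℝ] ℂ) = 0 := mfderiv_zero_of_not_mdifferentiableAt hχ
    simp [weight_apply, this]
  have hχ' : MDifferentiableAt 𝓘(ℝ, E) 𝓘(ℝ, ℂ) (charFun ρ α) (γ 0) := by rwa [map_zero]
  have hγ0 : MDifferentiableAt 𝓘(ℝ, ℝ) 𝓘(ℝ, E) γ 0 := hγ.mdifferentiableAt (by simp)
  have hc := mfderiv_comp (0 : ℝ) hχ' hγ0
  have hcd : MDifferentiableAt 𝓘(ℝ, ℝ) 𝓘(ℝ, ℂ) (charFun ρ α ∘ γ) 0 := hχ'.comp _ hγ0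
  have hd0 : ∀ g : G, g = 0 → ∀ v : E,
      (mfderiv 𝓘(ℝ, E) 𝓘(ℝ, ℂ) (charFun ρ α) g v : ℂ) = dChar ρ α v := by
    rintro _ rfl v; rfl
  have hfd : HasDerivAt (charFun ρ α ∘ γ) (dChar ρ α (velocity E γ)) 0 := by
    have h2 := hcd.differentiableAt.hasDerivAt
    rw [← fderiv_apply_one_eq_deriv, ← mfderiv_eq_fderiv, hc] at h2
    rw [← hd0 (γ 0) (map_zero γ)]
    exact h2
  have hexp := hom_eq_exp (f := charFun ρ α ∘ γ) (by simp [charFun])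
    (fun s t => by simp [charFun, AddCircle.toCircle_add]) hfd 1
  rw [Function.comp_apply, h1] at hexp
  have h3 : (1 : ℂ) = Complex.exp (dChar ρ α (velocity E γ)) := by
    simpa [charFun] using hexp
  obtain ⟨n, hn⟩ := Complex.exp_eq_one_iff.1 h3.symm
  refine ⟨n, ?_⟩
  have : (n * (2 * Real.pi * Complex.I) : ℂ).im = n * (2 * Real.pi) := by simp
  rw [weight_apply, hn, this]
  have := Real.pi_ne_zero
  field_simp

/-- The homomorphism `ρ̇ : ℤ_G → ℤ^d` induced by `ρ : G → 𝕋^d`, i.e. the restriction of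
`dρ : Lie G → ℝ^d`. -/
def rhoDot [LieAddGroup 𝓘(ℝ, E) ∞ G] {d : ℕ} (ρ : G →ₜ+ (Fin d → UnitAddCircle)) :
    expKer E G →+ (Fin d → ℤ) where
  toFun ξ α := (weight_int ρ α ξ).choose
  map_zero' := by
    funext α
    have h := (weight_int ρ α (0 : expKer E G)).choose_spec
    have h0 : weight ρ α ((0 : expKer E G) : E) = 0 := by simp
    exact_mod_cast h.symm.trans h0
  map_add' ξ η := by
    funext α
    have h := (weight_int ρ α (ξ + η)).choose_spec
    have h0 : weight ρ α ((ξ + η : expKer E G) : E)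
        = (weight_int ρ α ξ).choose + (weight_int ρ α η).choose := by
      rw [AddSubgroup.coe_add, map_add]
      exact congrArg₂ _ (weight_int ρ α ξ).choose_spec (weight_int ρ α η).choose_spec
    exact_mod_cast h.symm.trans h0

theorem rhoDot_apply [LieAddGroup 𝓘(ℝ, E) ∞ G] {d : ℕ} (ρ : G →ₜ+ (Fin d → UnitAddCircle))
    (ξ : expKer E G) (α : Fin d) : (rhoDot ρ ξ α : ℝ) = weight ρ α (ξ : E) :=
  (weight_int ρ α ξ).choose_spec.symm

/-! ### Symplectic quotients of `ℂ^d` -/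

/-- The linear action of `𝕋^d` on `ℂ^d`, `[θ] · z = (e^{-2πi θ_α} z_α)_α`. -/
def torusAct {d : ℕ} (θ : Fin d → UnitAddCircle) (z : Fin d → ℂ) : Fin d → ℂ :=
  fun α => ((-θ α).toCircle : ℂ) * z α

/-- The moment map `μ(z) = π ∑ |z_α|² w^α`. -/
def momentMap {d : ℕ} (ρ : G →ₜ+ (Fin d → UnitAddCircle)) (z : Fin d → ℂ) : E →L[ℝ] ℝ :=
  ∑ α, (Real.pi * ‖z α‖ ^ 2) • weight ρ α

/-- The level set `μ⁻¹(τ)`. -/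
def levelSet {d : ℕ} (ρ : G →ₜ+ (Fin d → UnitAddCircle)) (τ : E →L[ℝ] ℝ) : Set (Fin d → ℂ) :=
  {z | momentMap ρ z = τ}

/-- The hypotheses on `(G, ρ, τ)` under which the symplectic quotient is formed. -/
structure QuotientHyp {d : ℕ} (ρ : G →ₜ+ (Fin d → UnitAddCircle)) (τ : E →L[ℝ] ℝ) : Prop where
  regular : ∀ z ∈ levelSet ρ τ,
    Function.Surjective (fderiv ℝ (momentMap ρ : (Fin d → ℂ) → (E →L[ℝ] ℝ)) z)
  nonempty : (levelSet ρ τ).Nonempty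
  proper : IsProperMap (momentMap ρ : (Fin d → ℂ) → (E →L[ℝ] ℝ))

end LieData

/-! ### The category of smooth manifolds and quotient stacks -/

/-- A smooth manifold: Hausdorff, second countable, locally modelled on `ℝ^dim`. -/
structure Mfd : Type 1 where
  carrier : Type
  dim : ℕ
  [top : TopologicalSpace carrier]
  [charted : ChartedSpace (EuclideanSpace ℝ (Fin dim)) carrier]
  [smooth : IsManifold (𝓡 dim) ∞ carrier]
  [t2 : T2Space carrier]
  [secondCountable : SecondCountableTopology carrier]

attribute [instance] Mfd.top Mfd.charted Mfd.smooth Mfd.t2 Mfd.secondCountable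

instance : CoeSort Mfd Type := ⟨Mfd.carrier⟩

/-- The category of smooth manifolds and smooth maps. -/
instance : Category Mfd where
  Hom U V := C^∞⟮𝓡 U.dim, U; 𝓡 V.dim, V⟯
  id U := ContMDiffMap.id
  comp f g := g.comp f

/-- The smooth map underlying a morphism of `Mfd`. -/
def Mfd.app {U V : Mfd} (f : U ⟶ V) : U → V :=
  (show C^∞⟮𝓡 U.dim, U; 𝓡 V.dim, V⟯ from f)

section Stack

variable {E : Type} [NormedAddCommGroup E] [NormedSpace ℝ E]
  {G : Type} [AddCommGroup G] [TopologicalSpace G] [ChartedSpace E G]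

variable (E G) in
/-- A smooth (right) principal `G`-bundle over the manifold `U`. -/
structure PrincipalBundle (U : Mfd) where
  /-- The total space. -/
  total : Mfd
  /-- The bundle projection. -/
  proj : total ⟶ U
  /-- The right action. -/
  act : total → G → total
  act_smooth : ContMDiff ((𝓡 total.dim).prod 𝓘(ℝ, E)) (𝓡 total.dim) ∞
    (fun x : total × G => act x.1 x.2)
  act_zero : ∀ p, act p 0 = p
  act_add : ∀ p g h, act p (g + h) = act (act p g) h
  proj_act : ∀ p g, Mfd.app proj (act p g) = Mfd.app proj p
  /-- Around each point of the base there is a smooth equivariant local trivialization. -/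
  locally_trivial : ∀ u : U, ∃ V : Set U, IsOpen V ∧ u ∈ V ∧
    ∃ φ : OpenPartialHomeomorph total (U × G),
      φ.source = Mfd.app proj ⁻¹' V ∧ φ.target = V ×ˢ Set.univ ∧
      ContMDiffOn (𝓡 total.dim) ((𝓡 U.dim).prod 𝓘(ℝ, E)) ∞ φ φ.source ∧
      ContMDiffOn ((𝓡 U.dim).prod 𝓘(ℝ, E)) (𝓡 total.dim) ∞ φ.symm φ.target ∧
      (∀ p ∈ φ.source, (φ p).1 = Mfd.app proj p) ∧
      ∀ p ∈ φ.source, ∀ g, φ (act p g) = ((φ p).1, (φ p).2 + g)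

/-- An object `U ← P → μ⁻¹(τ)` of the quotient stack `[μ⁻¹(τ) / G]`: a principal `G`-bundle
`P → U` with a smooth equivariant map to the level set. The level set is an embedded submanifold
of `ℂ^d`, so that a map into it is smooth if and only if it is smooth as a map to `ℂ^d`. -/
structure QuotObj {d : ℕ} (ρ : G →ₜ+ (Fin d → UnitAddCircle)) (τ : E →L[ℝ] ℝ) : Type 1 where
  base : Mfd
  bundle : PrincipalBundle E G base
  ε : bundle.total → (Fin d → ℂ)
  ε_smooth : ContMDiff (𝓡 bundle.total.dim) 𝓘(ℝ, Fin d → ℂ) ∞ ε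
  ε_mem : ∀ p, ε p ∈ levelSet ρ τ
  /-- `ε (p · g) = g⁻¹ · ε p`. -/
  ε_act : ∀ p g, ε (bundle.act p g) = torusAct (ρ (-g)) (ε p)

variable {d : ℕ} {ρ : G →ₜ+ (Fin d → UnitAddCircle)} {τ : E →L[ℝ] ℝ}

/-- A morphism `(f, f̃)` of `[μ⁻¹(τ) / G]`. -/
@[ext]
structure QuotHom (x y : QuotObj ρ τ) where
  onBase : x.base ⟶ y.base
  onTotal : x.bundle.total ⟶ y.bundle.total
  comm : onTotal ≫ y.bundle.proj = x.bundle.proj ≫ onBase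
  equivariant : ∀ p g, Mfd.app onTotal (x.bundle.act p g) = y.bundle.act (Mfd.app onTotal p) g
  ε_comm : ∀ p, y.ε (Mfd.app onTotal p) = x.ε p

instance : Category (QuotObj ρ τ) where
  Hom := QuotHom
  id x := ⟨𝟙 _, 𝟙 _, by simp, fun _ _ => rfl, fun _ => rfl⟩
  comp {x y z} f g := ⟨f.onBase ≫ g.onBase, f.onTotal ≫ g.onTotal,
    by rw [Category.assoc, g.comm, ← Category.assoc, f.comm, Category.assoc],
    fun p a => by
      change Mfd.app g.onTotal (Mfd.app f.onTotal _) = z.bundle.act (Mfd.app g.onTotal _) a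
      rw [f.equivariant, g.equivariant]; rfl,
    fun p => by
      change z.ε (Mfd.app g.onTotal (Mfd.app f.onTotal p)) = _
      rw [g.ε_comm, f.ε_comm]⟩
  id_comp _ := QuotHom.ext (Category.id_comp _) (Category.id_comp _)
  comp_id _ := QuotHom.ext (Category.comp_id _) (Category.comp_id _)
  assoc _ _ _ := QuotHom.ext (Category.assoc _ _ _) (Category.assoc _ _ _)

variable (ρ τ) in
/-- The symplectic quotient `ℂ^d //_τ G = [μ⁻¹(τ) / G]`, as a category over `Mfd`. -/
def symplecticQuotient : BasedCategory.{0, 1} Mfd :=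
  BasedCategory.ofFunctor (𝒳 := QuotObj ρ τ)
    { obj := fun x => x.base, map := fun f => QuotHom.onBase f }

/-- The object of `[μ⁻¹(τ) / G]` underlying an object of the symplectic quotient. -/
def toObj (x : (symplecticQuotient ρ τ).obj) : QuotObj ρ τ := x

/-- The morphism of `[μ⁻¹(τ) / G]` underlying a morphism of the symplectic quotient. -/
def toHom {x y : (symplecticQuotient ρ τ).obj} (f : x ⟶ y) : QuotHom (toObj x) (toObj y) := f

/-- The morphism of stacks `F : [M' / G'] → [M / G]` is given by the change of structure group
along `Φ : G ≃ G'`: naturally in the object `U ← P → M'`, its image is isomorphic over `U` to `P`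
with the same map `ε` and with `g ∈ G` acting as `Φ g`. -/
def IsChangeOfGroup
    {E' : Type} [NormedAddCommGroup E'] [NormedSpace ℝ E']
    {G' : Type} [AddCommGroup G'] [TopologicalSpace G'] [ChartedSpace E' G']
    {ρ' : G' →ₜ+ (Fin d → UnitAddCircle)} {τ' : E' →L[ℝ] ℝ} (Φ : G ≃+ G')
    (F : BasedFunctor (symplecticQuotient ρ' τ') (symplecticQuotient ρ τ)) : Prop :=
  ∃ j : ∀ x, (toObj x).bundle.total ≅ (toObj (F.obj x)).bundle.total,
    (∀ x, (j x).hom ≫ (toObj (F.obj x)).bundle.proj ≫ eqToHom (F.w_obj x)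
      = (toObj x).bundle.proj) ∧
    (∀ x p, (toObj (F.obj x)).ε (Mfd.app (j x).hom p) = (toObj x).ε p) ∧
    (∀ x p g, Mfd.app (j x).hom ((toObj x).bundle.act p (Φ g))
      = (toObj (F.obj x)).bundle.act (Mfd.app (j x).hom p) g) ∧
    ∀ {x y} (f : x ⟶ y), (toHom f).onTotal ≫ (j y).hom = (j x).hom ≫ (toHom (F.map f)).onTotal

end Stack

/-! ### The Gale dual of `β : ℤ^d → N` -/

/-- A resolution `⋯ → X₂ → X₁ → X₀ → M → 0` of an abelian group by free abelian groups of finite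
rank. -/
structure FreeResolution (M : Type) [AddCommGroup M] where
  X : ℕ → Type
  [grp : ∀ i, AddCommGroup (X i)]
  [free : ∀ i, Module.Free ℤ (X i)]
  [finite : ∀ i, Module.Finite ℤ (X i)]
  bd : ∀ i, X (i + 1) →+ X i
  aug : X 0 →+ M
  aug_surjective : Function.Surjective aug
  exact_zero : Function.Exact (bd 0) aug
  exact_succ : ∀ i, Function.Exact (bd (i + 1)) (bd i)

attribute [instance] FreeResolution.grp FreeResolution.free FreeResolution.finite

/-- A chain map `P → Q` of resolutions lifting `β : M → N`. -/
structure ChainLift {M N : Type} [AddCommGroup M] [AddCommGroup N] (β : M →+ N)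
    (P : FreeResolution M) (Q : FreeResolution N) where
  f : ∀ i, P.X i →+ Q.X i
  comm_aug : Q.aug.comp (f 0) = β.comp P.aug
  comm : ∀ i, (f i).comp (P.bd i) = (Q.bd i).comp (f (i + 1))

namespace ChainLift

variable {M N : Type} [AddCommGroup M] [AddCommGroup N] {β : M →+ N}
  {P : FreeResolution M} {Q : FreeResolution N} (b : ChainLift β P Q)

/-- The differential of the mapping cone from degree `1` to degree `0`,
`P₀ ⊕ Q₁ → Q₀, (e, f) ↦ ∂ f - b e`. -/
def coneD₁ : P.X 0 × Q.X 1 →+ Q.X 0 :=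
  (Q.bd 0).comp (AddMonoidHom.snd _ _) - (b.f 0).comp (AddMonoidHom.fst _ _)

/-- The differential of the mapping cone from degree `2` to degree `1`,
`P₁ ⊕ Q₂ → P₀ ⊕ Q₁, (e, f) ↦ (-∂ e, ∂ f - b e)`. -/
def coneD₂ : P.X 1 × Q.X 2 →+ P.X 0 × Q.X 1 :=
  (-(P.bd 0).comp (AddMonoidHom.fst _ _)).prod
    ((Q.bd 1).comp (AddMonoidHom.snd _ _) - (b.f 1).comp (AddMonoidHom.fst _ _))

/-- `1`-cocycles of the dual of the mapping cone. -/
def cocycles : AddSubgroup (P.X 0 × Q.X 1 →+ ℤ) where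
  carrier := {φ | φ.comp b.coneD₂ = 0}
  zero_mem' := AddMonoidHom.zero_comp _
  add_mem' {φ ψ} hφ hψ := by
    change (φ + ψ).comp _ = 0
    rw [AddMonoidHom.add_comp, hφ, hψ, add_zero]
  neg_mem' {φ} hφ := by
    change (-φ).comp _ = 0
    rw [AddMonoidHom.neg_comp, hφ, neg_zero]

/-- `1`-coboundaries of the dual of the mapping cone. -/
def coboundaries : AddSubgroup (P.X 0 × Q.X 1 →+ ℤ) where
  carrier := {φ | ∃ ψ : Q.X 0 →+ ℤ, φ = ψ.comp b.coneD₁}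
  zero_mem' := ⟨0, (AddMonoidHom.zero_comp _).symm⟩
  add_mem' := by
    rintro _ _ ⟨φ, rfl⟩ ⟨ψ, rfl⟩
    exact ⟨φ + ψ, (AddMonoidHom.add_comp _ _ _).symm⟩
  neg_mem' := by
    rintro _ ⟨φ, rfl⟩
    exact ⟨-φ, (AddMonoidHom.neg_comp _ _).symm⟩

theorem coneD₁_comp_coneD₂ : b.coneD₁.comp b.coneD₂ = 0 := by
  ext ⟨e, f⟩
  have h1 := DFunLike.congr_fun (b.comm 0) e
  have h2 : Q.bd 0 (Q.bd 1 f) = 0 := (Q.exact_succ 0).apply_apply_eq_zero f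
  simp only [AddMonoidHom.comp_apply] at h1
  simp [coneD₁, coneD₂, h1, h2]

theorem coboundaries_le_cocycles : b.coboundaries ≤ b.cocycles := by
  rintro _ ⟨ψ, rfl⟩
  change (ψ.comp _).comp _ = 0
  rw [AddMonoidHom.comp_assoc, coneD₁_comp_coneD₂, AddMonoidHom.comp_zero]

/-- The Gale dual `DG(β) = H¹(Cone(β)^∨)`. -/
abbrev DG : Type := b.cocycles ⧸ b.coboundaries.addSubgroupOf b.cocycles

/-- The homomorphism `β^DG : M^∨ → DG(β)`, induced by the projection of the cone to the shift of
`P`. -/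
def toDG : (M →+ ℤ) →+ b.DG :=
  (QuotientAddGroup.mk' _).comp
    { toFun := fun φ => ⟨(φ.comp P.aug).comp (AddMonoidHom.fst _ _), by
        change ((φ.comp P.aug).comp _).comp _ = 0
        ext ⟨e, f⟩
        have : P.aug (P.bd 0 e) = 0 := P.exact_zero.apply_apply_eq_zero e
        simp [coneD₂, this]⟩
      map_zero' := rfl
      map_add' := fun _ _ => rfl }

instance : Module.Finite ℤ b.DG := by
  have h : Module.Finite ℤ (P.X 0 × Q.X 1 →+ ℤ) :=
    Module.Finite.equiv (addMonoidHomLequivInt (A := P.X 0 × Q.X 1) (B := ℤ) ℤ).symm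
  have h1 : Module.Finite ℤ b.cocycles :=
    inferInstanceAs (Module.Finite ℤ (AddSubgroup.toIntSubmodule b.cocycles))
  exact Module.Finite.of_surjective
    (QuotientAddGroup.mk' (b.coboundaries.addSubgroupOf b.cocycles)).toIntLinearMap
    (QuotientAddGroup.mk'_surjective _)

end ChainLift

/-! ### Stacky polytopes -/

section Polytope

/-- The vector space `𝔱 = N ⊗ ℝ`. -/
abbrev TSpace (N : Type) [AddCommGroup N] : Type := TensorProduct ℤ ℝ N

/-- The dual `𝔱^∨ = N^∨ ⊗ ℝ` of `𝔱 = N ⊗ ℝ`. -/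
abbrev TDual (N : Type) [AddCommGroup N] : Type := Module.Dual ℝ (TSpace N)

variable {N : Type} [AddCommGroup N] {d : ℕ}

/-- A face of `Δ`: the set of points at which a linear functional is minimal on `Δ`. -/
def IsFace (Δ F : Set (TDual N)) : Prop :=
  ∃ x : TSpace N, F = {η ∈ Δ | ∀ η' ∈ Δ, η x ≤ η' x}

/-- A facet of `Δ ⊆ 𝔱^∨`: a nonempty face of codimension one in `𝔱^∨`. -/
def IsFacet (Δ F : Set (TDual N)) : Prop :=
  IsFace Δ F ∧ F.Nonempty ∧
    Module.finrank ℝ (vectorSpan ℝ F) + 1 = Module.finrank ℝ (TDual N)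

/-- The vector `n̄_α`, the image of `β(e_α)` in `𝔱 = N ⊗ ℝ`. -/
def nbar (β : (Fin d → ℤ) →+ N) (α : Fin d) : TSpace N :=
  TensorProduct.tmul ℤ (1 : ℝ) (β (Pi.single α 1))

/-- `(N, Δ, β)` is a stacky polytope, `F₁, …, F_d` being the facets of the polytope `Δ`. An entry
of the list `F₁, …, F_d` is allowed to be empty; each (nonempty) facet occurs exactly once in it. -/
structure IsStackyPolytope (β : (Fin d → ℤ) →+ N) (Δ : Set (TDual N))
    (F : Fin d → Set (TDual N)) : Prop where
  finitelyGenerated : Module.Finite ℤ N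
  polytope : ∃ S : Set (TDual N), S.Finite ∧ S.Nonempty ∧ Δ = convexHull ℝ S
  fullDimensional : vectorSpan ℝ Δ = ⊤
  facet_or_empty : ∀ α, IsFacet Δ (F α) ∨ F α = ∅
  facets_listed : ∀ F', IsFacet Δ F' → ∃! α, F α = F'
  /-- Every vertex lies in exactly `r = rank N` facets. -/
  simple : ∀ v ∈ Set.extremePoints ℝ Δ,
    {F' | IsFacet Δ F' ∧ v ∈ F'}.ncard = Module.finrank ℤ N
  /-- `n̄_α` is an inward-pointing normal of `F_α`. -/
  inward : ∀ α, (F α).Nonempty → nbar β α ≠ 0 ∧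
    F α = {η ∈ Δ | ∀ η' ∈ Δ, η (nbar β α) ≤ η' (nbar β α)}
  finite_coker : Finite (N ⧸ β.range)

/-- The constants `c_α` with `Δ = {η | ⟨η, n̄_α⟩ ≥ -c_α for all α}`, where equality for `α` holds on
`F_α`. -/
def IsSupport (β : (Fin d → ℤ) →+ N) (Δ : Set (TDual N)) (F : Fin d → Set (TDual N))
    (c : Fin d → ℝ) : Prop :=
  Δ = {η | ∀ α, -c α ≤ η (nbar β α)} ∧ ∀ α, F α = {η ∈ Δ | η (nbar β α) = -c α}

/-- If no `F_α` is empty, the constants `c_α` are determined by the stacky polytope. -/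
theorem IsSupport.unique {β : (Fin d → ℤ) →+ N} {Δ : Set (TDual N)} {F : Fin d → Set (TDual N)}
    {c c' : Fin d → ℝ} (h : IsSupport β Δ F c) (h' : IsSupport β Δ F c')
    (hF : ∀ α, (F α).Nonempty) : c = c' := by
  funext α
  obtain ⟨η, hη⟩ := hF α
  have h1 : η ∈ {η ∈ Δ | η (nbar β α) = -c α} := h.2 α ▸ hη
  have h2 : η ∈ {η ∈ Δ | η (nbar β α) = -c' α} := h'.2 α ▸ hη
  exact neg_injective (h1.2.symm.trans h2.2)

/-- The linear map `ℝ^d → 𝔱` induced by `β`, `e_α ↦ n̄_α`; it is the derivative of the homomorphism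
of tori `σ : 𝕋^d → T = 𝔱 / Λ`. -/
def sigmaLin (β : (Fin d → ℤ) →+ N) : (Fin d → ℝ) →ₗ[ℝ] TSpace N :=
  Fintype.linearCombination ℝ (nbar β)

/-- The linear map `s : 𝔱 → ℝ^d` is the derivative of a homomorphism of tori
`T = 𝔱 / Λ → 𝕋^d = ℝ^d / ℤ^d` (i.e. it maps the lattice `Λ`, the image of `N`, into `ℤ^d`) that is a
section of `σ : 𝕋^d → T`. -/
def IsTorusSection (β : (Fin d → ℤ) →+ N) (s : TSpace N →ₗ[ℝ] (Fin d → ℝ)) : Prop :=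
  (∀ (n : N) (α : Fin d), ∃ k : ℤ, s (TensorProduct.tmul ℤ (1 : ℝ) n) α = k) ∧
    ∀ x : TSpace N, ∃ n : N, sigmaLin β (s x) - x = TensorProduct.tmul ℤ (1 : ℝ) n

/-- The reduced moment map `μ̄(z) = ∑ (π|z_α|² - c_α) s^∨(e^α)`, with values in `𝔱^∨`. -/
def reducedMomentMap (c : Fin d → ℝ) (s : TSpace N →ₗ[ℝ] (Fin d → ℝ)) (z : Fin d → ℂ) : TDual N :=
  ∑ α, (Real.pi * ‖z α‖ ^ 2 - c α) • ((LinearMap.proj α : (Fin d → ℝ) →ₗ[ℝ] ℝ) ∘ₗ s)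

end Polytope

/-! ### The stack associated to a stacky polytope -/

section Associated

variable {N : Type} [AddCommGroup N] {d : ℕ} {β : (Fin d → ℤ) →+ N}
  {P : FreeResolution (Fin d → ℤ)} {Q : FreeResolution N} (b : ChainLift β P Q)

/-- The coordinate functional `e^α ∈ (ℤ^d)^∨`. -/
def coordZ (α : Fin d) : (Fin d → ℤ) →+ ℤ := Pi.evalAddMonoidHom (fun _ => ℤ) α

/-- The homomorphism `Hom(DG(β), 𝕋) → Hom((ℤ^d)^∨, 𝕋) = 𝕋^d` induced by `β^DG`. -/
def rhoDG : CharGroup b.DG →ₜ+ (Fin d → UnitAddCircle) where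
  toFun h α := h (b.toDG (coordZ α))
  map_zero' := rfl
  map_add' _ _ := rfl
  continuous_toFun := continuous_pi fun _ => CharGroup.continuous_eval _

/-- The covector `τ = ∑ c_α w^α` on the Lie algebra of `Hom(DG(β), 𝕋)`. -/
def tauDG (c : Fin d → ℝ) : CharGroup.Model b.DG →L[ℝ] ℝ := ∑ α, c α • weight (rhoDG b) α

/-- The stack `𝒳` associated to the stacky polytope `(N, Δ, β)` with support constants `c`:
the symplectic quotient of `ℂ^d` by `Hom(DG(β), 𝕋)` at `τ = ∑ c_α w^α`. -/
def stackyPolytopeStack (c : Fin d → ℝ) : BasedCategory.{0, 1} Mfd :=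
  symplecticQuotient (rhoDG b) (tauDG b c)

end Associated

end

end ToricStack

open ToricStack

open scoped Manifold ContDiff Topology
open Topology CategoryTheory

namespace ToricStack

noncomputable section

/-! ### Polyhedra with linearly independent active constraints -/

section Polyhedron

variable {V : Type*} [AddCommGroup V] [Module ℝ V] {d : ℕ}

/-! Since `∑ c_α w^α = τ`, a point `z` lies in the level set exactly when the numbers `x_α = π|z_α|²
- c_α` satisfy `∑ x_α w^α = 0`. The integral lattice spans the Lie algebra and its image in `ℤ^d` is
`ker β`, so this holds exactly when `x_α = ⟨η, n̄_α⟩` for some `η ∈ 𝔱^∨` (`exists_tdual`,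
`sum_tdual_smul_weight`). As `π|z_α|²` can be any nonnegative number, the `η` that occur are exactly
the points of `Δ`, and the constraint `α` is sharp at `η` exactly when `z_α = 0`. Any section `s`
satisfies `σ ∘ s = id` on Lie algebras (`sigmaLin_section`), so `η` is the value of the reduced
moment map at `z`.

Regularity of `τ` says that only `ξ = 0` is killed by all `w^α` with `z_α ≠ 0`. A linear relation
among the normals of the sharp constraints at `η` has the form `a_α = w^α(ξ)`, because `𝔤 → ℝ^d → 𝔱`
is exact in the middle. This `ξ` is killed by all those weights, so it is zero and the relation is
trivial (`linearIndependent_active`). Properness makes the level set compact, so `Δ` contains no ray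
(`tdual_eq_zero_of_nonneg`). The remaining statements on `Δ` are convex geometry: with independent
sharp normals, any subset of the sharp constraints can be made slack by a small move, which gives
the dimensions and distinctness of the nonempty `F_α`, and the absence of rays makes the polyhedron
the hull of its vertices (`isStackyPolytope_polyhedron`).

For the stack, the cone of `β` has degree-zero homology `coker β = 0` and degree-one homology `ker β
≅ ℤ_G`; the latter isomorphism uses that `ρ̇` is injective, again by regularity. Splitting off the
free group `Q₀` gives `DG(β) ≅ ℤ_G^∨` (`exists_DG_equiv`). Hence `Hom(DG(β), 𝕋)` is `𝔤 / ℤ_G = G`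
(`toCharGroup`), compatibly with `ρ` and `τ`, and the two level sets in `ℂ^d` are equal. Change of
structure group then keeps the total space and the map to `ℂ^d` and only relabels the acting group,
so it is an equivalence with inverse of the same kind (`QuotientIso.equivalence`). -/

/-- The polyhedron in `V^∨` cut out by the inequalities `⟨η, n_α⟩ ≥ -c_α`. -/
def polyhedron (n : Fin d → V) (c : Fin d → ℝ) : Set (Module.Dual ℝ V) :=
  {η | ∀ α, -c α ≤ η (n α)}

/-- The indices of the constraints that are sharp at `η`. -/
def active (n : Fin d → V) (c : Fin d → ℝ) (η : Module.Dual ℝ V) : Set (Fin d) :=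
  {α | η (n α) = -c α}

variable {n : Fin d → V} {c : Fin d → ℝ}

theorem exists_dual_eq_of_linearIndependent {ι : Type*} {v : ι → V} (hv : LinearIndependent ℝ v)
    (t : ι → ℝ) : ∃ u : Module.Dual ℝ V, ∀ i, u (v i) = t i := by
  obtain ⟨u, hu⟩ := LinearMap.exists_extend (p := Submodule.span ℝ (Set.range v))
    ((Finsupp.linearCombination ℝ t) ∘ₗ hv.repr)
  refine ⟨u, fun i => ?_⟩
  have h := LinearMap.congr_fun hu ⟨v i, Submodule.subset_span ⟨i, rfl⟩⟩
  have h2 := hv.repr_eq_single i ⟨v i, Submodule.subset_span ⟨i, rfl⟩⟩ rfl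
  simp only [LinearMap.comp_apply, Submodule.subtype_apply] at h
  rw [h, h2]
  simp

/-- These are finitely many strict inequalities that hold at `t = 0`. The absolute value lets one
step size serve both directions `±v`. -/
theorem exists_small_step (η v : Module.Dual ℝ V) :
    ∃ t > (0 : ℝ), ∀ α, -c α < η (n α) → t * |v (n α)| < η (n α) + c α := by
  have h : ∀ α, ∀ᶠ t in 𝓝[>] (0 : ℝ), -c α < η (n α) → t * |v (n α)| < η (n α) + c α := by
    intro α
    by_cases hα : -c α < η (n α)
    · have hc : ContinuousAt (fun t : ℝ => t * |v (n α)|) 0 := by fun_prop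
      have := hc.eventually_lt (continuousAt_const (y := η (n α) + c α)) (by linarith)
      filter_upwards [this.filter_mono nhdsWithin_le_nhds] with t ht _ using ht
    · exact Filter.Eventually.of_forall fun t ht => absurd ht hα
  obtain ⟨t, ht, ht0⟩ := ((Filter.eventually_all.2 h).and self_mem_nhdsWithin).exists
  exact ⟨t, ht0, ht⟩

theorem lt_of_mem_polyhedron {η : Module.Dual ℝ V} (hη : η ∈ polyhedron n c) {α : Fin d}
    (hα : α ∉ active n c η) : -c α < η (n α) :=
  lt_of_le_of_ne (hη α) (Ne.symm hα)

/-- Any subset of the sharp constraints at a point is the set of sharp constraints at a point. -/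
theorem exists_active_eq {η : Module.Dual ℝ V} (hη : η ∈ polyhedron n c)
    (hli : LinearIndependent ℝ (fun α : active n c η => n α)) {s : Set (Fin d)}
    (hs : s ⊆ active n c η) : ∃ η' ∈ polyhedron n c, active n c η' = s := by
  classical
  -- Moving along `u` keeps the constraints in `s` sharp and loosens the other sharp ones; the step
  -- is short enough for the slack constraints to remain slack.
  obtain ⟨u, hu⟩ := exists_dual_eq_of_linearIndependent hli
    (fun α => if (α : Fin d) ∈ s then 0 else 1)
  obtain ⟨t, ht, htc⟩ := exists_small_step (n := n) (c := c) η u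
  have key : ∀ α, (α ∈ s → (η + t • u) (n α) = -c α) ∧ (α ∉ s → -c α < (η + t • u) (n α)) := by
    intro α
    by_cases hα : α ∈ active n c η
    · have h1 := hu ⟨α, hα⟩
      have h2 : η (n α) = -c α := hα
      simp only at h1
      constructor <;> intro h3 <;> simp [h1, h2, h3, ht]
    · have h1 := htc α (lt_of_mem_polyhedron hη hα)
      refine ⟨fun h => absurd (hs h) hα, fun _ => ?_⟩
      have := mul_le_mul_of_nonneg_left (neg_abs_le (u (n α))) ht.le
      simp only [LinearMap.add_apply, LinearMap.smul_apply, smul_eq_mul]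
      linarith
  refine ⟨η + t • u, fun α => ?_, Set.ext fun α => ⟨fun h => ?_, fun h => (key α).1 h⟩⟩
  · by_cases h : α ∈ s
    exacts [((key α).1 h).ge, ((key α).2 h).le]
  · by_contra hα
    exact ((key α).2 hα).ne' h

/-- Moving from `η` in a direction `v` that is constant on the sharp constraints. -/
theorem exists_add_smul_mem {η : Module.Dual ℝ V} (hη : η ∈ polyhedron n c) {v : Module.Dual ℝ V}
    (hv : ∀ α ∈ active n c η, v (n α) = 0) :
    ∃ t > (0 : ℝ), η + t • v ∈ polyhedron n c ∧ η - t • v ∈ polyhedron n c := by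
  obtain ⟨t, ht, htc⟩ := exists_small_step (n := n) (c := c) η v
  have key : ∀ α, |t * v (n α)| ≤ η (n α) + c α := by
    intro α
    by_cases hα : α ∈ active n c η
    · rw [hv α hα, mul_zero, abs_zero]; linarith [hη α]
    · rw [abs_mul, abs_of_pos ht]
      exact (htc α (lt_of_mem_polyhedron hη hα)).le
  refine ⟨t, ht, fun α => ?_, fun α => ?_⟩
  all_goals
    have := abs_le.1 (key α)
    simp only [LinearMap.add_apply, LinearMap.sub_apply, LinearMap.smul_apply, smul_eq_mul]
    linarith [this.1, this.2]

theorem mem_vectorSpan_of_smul {F : Set (Module.Dual ℝ V)} {η v : Module.Dual ℝ V} (hη : η ∈ F)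
    {t : ℝ} (ht : 0 < t) (h : η + t • v ∈ F) : v ∈ vectorSpan ℝ F := by
  have h1 : t • v ∈ vectorSpan ℝ F := by
    have := vsub_mem_vectorSpan ℝ h hη
    simpa using this
  simpa [smul_smul, ht.ne'] using (vectorSpan ℝ F).smul_mem t⁻¹ h1

/-- By independence there is a point at which no constraint is sharp, and from it every direction is
admissible. -/
theorem vectorSpan_polyhedron (hne : (polyhedron n c).Nonempty)
    (hli : ∀ η ∈ polyhedron n c, LinearIndependent ℝ (fun α : active n c η => n α)) :
    vectorSpan ℝ (polyhedron n c) = ⊤ := by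
  obtain ⟨η, hη⟩ := hne
  obtain ⟨η', hη', ha⟩ := exists_active_eq hη (hli η hη) (Set.empty_subset _)
  refine eq_top_iff.2 fun v _ => ?_
  obtain ⟨t, ht, h, -⟩ := exists_add_smul_mem hη' (v := v) (by simp [ha])
  exact mem_vectorSpan_of_smul hη' ht h

/-- The part of the polyhedron on which the `α`-th constraint is sharp. -/
def polyFace (n : Fin d → V) (c : Fin d → ℝ) (α : Fin d) : Set (Module.Dual ℝ V) :=
  {η ∈ polyhedron n c | η (n α) = -c α}

theorem vectorSpan_le_ker {F : Set (Module.Dual ℝ V)} {x : V} {m : ℝ} (h : ∀ η ∈ F, η x = m) :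
    vectorSpan ℝ F ≤ LinearMap.ker (Module.Dual.eval ℝ V x) := by
  rw [vectorSpan_def, Submodule.span_le]
  rintro _ ⟨η, hη, η', hη', rfl⟩
  simp [h η hη, h η' hη']

/-- There is a point at which `α` is the only sharp constraint. From it one stays in the face in
every direction that annihilates `n α`. -/
theorem vectorSpan_polyFace
    (hli : ∀ η ∈ polyhedron n c, LinearIndependent ℝ (fun α : active n c η => n α)) {α : Fin d}
    (hne : (polyFace n c α).Nonempty) :
    vectorSpan ℝ (polyFace n c α) = LinearMap.ker (Module.Dual.eval ℝ V (n α)) := by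
  obtain ⟨η, hη, hα⟩ := hne
  refine le_antisymm (vectorSpan_le_ker fun η hη => hη.2) fun v hv => ?_
  obtain ⟨η', hη', ha⟩ := exists_active_eq hη (hli η hη) (Set.singleton_subset_iff.2 hα)
  have hv' : v (n α) = 0 := hv
  have hα' : η' (n α) = -c α := by
    have : α ∈ active n c η' := ha ▸ rfl
    exact this
  obtain ⟨t, ht, h, -⟩ := exists_add_smul_mem hη' (v := v) (by simp [ha, hv'])
  exact mem_vectorSpan_of_smul ⟨hη', hα'⟩ ht ⟨h, by simp [hv', hα']⟩

theorem finrank_ker_eval [FiniteDimensional ℝ V] {x : V} (hx : x ≠ 0) :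
    Module.finrank ℝ (LinearMap.ker (Module.Dual.eval ℝ V x)) + 1
      = Module.finrank ℝ (Module.Dual ℝ V) :=
  Module.Dual.finrank_ker_add_one_of_ne_zero
    (fun h => hx ((Module.forall_dual_apply_eq_zero_iff ℝ x).1 fun f => LinearMap.congr_fun h f))

theorem ne_zero_of_polyFace_nonempty
    (hli : ∀ η ∈ polyhedron n c, LinearIndependent ℝ (fun α : active n c η => n α)) {α : Fin d}
    (hne : (polyFace n c α).Nonempty) : n α ≠ 0 := by
  obtain ⟨η, hη, hα⟩ := hne
  exact (hli η hη).ne_zero ⟨α, hα⟩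

/-- Once the bound `-c α` is attained it is the minimum of `n α` on the polyhedron. -/
theorem polyFace_eq_minimizers {α : Fin d} (hne : (polyFace n c α).Nonempty) :
    polyFace n c α = {η ∈ polyhedron n c | ∀ η' ∈ polyhedron n c, η (n α) ≤ η' (n α)} := by
  obtain ⟨η₀, h₀, hα⟩ := hne
  ext η
  refine and_congr_right fun hη => ⟨fun h η' hη' => h ▸ hη' α, fun h => ?_⟩
  exact le_antisymm (hα ▸ h η₀ h₀) (hη α)

/-- A point at which only `α` is sharp lies in no other face of the list; hence no facet is listed
twice. -/
theorem eq_of_polyFace_subset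
    (hli : ∀ η ∈ polyhedron n c, LinearIndependent ℝ (fun α : active n c η => n α)) {α β : Fin d}
    (hne : (polyFace n c α).Nonempty) (h : polyFace n c α ⊆ polyFace n c β) : β = α := by
  obtain ⟨η, hη, hα⟩ := hne
  obtain ⟨η', hη', ha⟩ := exists_active_eq hη (hli η hη) (Set.singleton_subset_iff.2 hα)
  have hα' : α ∈ active n c η' := ha ▸ rfl
  have hβ : β ∈ active n c η' := (h ⟨hη', hα'⟩).2
  rw [ha] at hβ
  exact hβ

theorem convex_polyhedron : Convex ℝ (polyhedron n c) := by
  intro η hη η' hη' a b ha hb hab α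
  have h1 := mul_le_mul_of_nonneg_left (hη α) ha
  have h2 := mul_le_mul_of_nonneg_left (hη' α) hb
  have h3 : a * c α + b * c α = c α := by rw [← add_mul, hab, one_mul]
  simp only [LinearMap.add_apply, LinearMap.smul_apply, smul_eq_mul]
  linarith

/-- The set of minimizers of a nonzero linear functional lies in one of the `F_α`. -/
theorem exists_subset_polyFace [FiniteDimensional ℝ V] {x : V} (hx : x ≠ 0)
    {F : Set (Module.Dual ℝ V)}
    (hF : F = {η ∈ polyhedron n c | ∀ η' ∈ polyhedron n c, η x ≤ η' x}) (hne : F.Nonempty) :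
    ∃ α, F ⊆ polyFace n c α := by
  -- Without a sharp constraint one could move both ways along some `v` with `v x ≠ 0`, and one of
  -- the two moves would lower the value at `x`.
  have hact : ∀ η ∈ F, (active n c η).Nonempty := by
    intro η hη
    rw [hF] at hη
    by_contra hemp
    rw [Set.not_nonempty_iff_eq_empty] at hemp
    obtain ⟨v, hv⟩ : ∃ v : Module.Dual ℝ V, v x ≠ 0 := by
      by_contra! h
      exact hx ((Module.forall_dual_apply_eq_zero_iff ℝ x).1 h)
    obtain ⟨t, ht, h1, h2⟩ := exists_add_smul_mem hη.1 (v := v) (by simp [hemp])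
    have e1 := hη.2 _ h1
    have e2 := hη.2 _ h2
    simp only [LinearMap.add_apply, LinearMap.sub_apply, LinearMap.smul_apply, smul_eq_mul]
      at e1 e2
    exact mul_ne_zero ht.ne' hv (by linarith)
  by_contra! hcon
  have hcon' : ∀ α, ∃ η ∈ F, η (n α) ≠ -c α := by
    intro α
    obtain ⟨η, hη, h⟩ := Set.not_subset.1 (hcon α)
    have hp : η ∈ polyhedron n c := by rw [hF] at hη; exact hη.1
    exact ⟨η, hη, fun h' => h ⟨hp, h'⟩⟩
  choose p hp hpα using hcon'
  -- A sharp constraint exists, so `d > 0` and an average over the indices makes sense.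
  obtain ⟨α₀, -⟩ : (active n c hne.some).Nonempty := hact _ hne.some_mem
  have hd : (0 : ℝ) < d := by exact_mod_cast α₀.pos
  have hconv : Convex ℝ F := by
    rw [hF]
    intro η hη η' hη' a b ha hb hab
    refine ⟨convex_polyhedron hη.1 hη'.1 ha hb hab, fun ζ hζ => ?_⟩
    have h1 := mul_le_mul_of_nonneg_left (hη.2 ζ hζ) ha
    have h2 := mul_le_mul_of_nonneg_left (hη'.2 ζ hζ) hb
    have h3 : a * ζ x + b * ζ x = ζ x := by rw [← add_mul, hab, one_mul]
    simp only [LinearMap.add_apply, LinearMap.smul_apply, smul_eq_mul]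
    linarith
  -- Each `p α` is slack at `α`, so the average is slack at every constraint, although as a point of
  -- `F` it must have a sharp one.
  have havg : ∑ α, (d : ℝ)⁻¹ • p α ∈ F :=
    hconv.sum_mem (fun _ _ => by positivity) (by simp [hd.ne']) fun α _ => hp α
  obtain ⟨β, hβ⟩ := hact _ havg
  have hβ' : ∑ α, (d : ℝ)⁻¹ * p α (n β) = -c β := by
    have : (∑ α, (d : ℝ)⁻¹ • p α) (n β) = -c β := hβ
    simpa [LinearMap.sum_apply] using this
  have hmem : ∀ α, p α ∈ polyhedron n c := fun α => by
    have := hp α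
    rw [hF] at this
    exact this.1
  have hlt : ∑ _α : Fin d, (d : ℝ)⁻¹ * (-c β) < ∑ α, (d : ℝ)⁻¹ * p α (n β) := by
    refine Finset.sum_lt_sum (fun α _ => ?_) ⟨β, Finset.mem_univ _, ?_⟩
    · exact mul_le_mul_of_nonneg_left (hmem α β) (by positivity)
    · exact mul_lt_mul_of_pos_left (lt_of_le_of_ne (hmem β β) (hpα β).symm) (by positivity)
  rw [hβ'] at hlt
  simp only [Finset.sum_const, Finset.card_univ, Fintype.card_fin, nsmul_eq_mul] at hlt
  rw [← mul_assoc, mul_inv_cancel₀ hd.ne', one_mul] at hlt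
  exact lt_irrefl _ hlt

/-- A face of codimension one of the polyhedron is one of the `F_α`. -/
theorem exists_eq_polyFace [FiniteDimensional ℝ V]
    (hpne : (polyhedron n c).Nonempty)
    (hli : ∀ η ∈ polyhedron n c, LinearIndependent ℝ (fun α : active n c η => n α)) {x : V}
    {F : Set (Module.Dual ℝ V)}
    (hF : F = {η ∈ polyhedron n c | ∀ η' ∈ polyhedron n c, η x ≤ η' x}) (hne : F.Nonempty)
    (hdim : Module.finrank ℝ (vectorSpan ℝ F) + 1 = Module.finrank ℝ (Module.Dual ℝ V)) :
    ∃ α, polyFace n c α = F := by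
  have hx : x ≠ 0 := by
    rintro rfl
    have : F = polyhedron n c := by rw [hF]; simp
    rw [this, vectorSpan_polyhedron hpne hli, finrank_top] at hdim
    omega
  obtain ⟨α, hα⟩ := exists_subset_polyFace hx hF hne
  refine ⟨α, subset_antisymm (fun η hη => ?_) hα⟩
  have hnα := ne_zero_of_polyFace_nonempty hli (hne.mono hα)
  -- The inclusion of `F` in the face of `α` is an inclusion of sets with the same space of
  -- directions. Since `x` is constant on `F`, it is constant on the whole face, which therefore
  -- consists of minimizers.
  have hspan : vectorSpan ℝ F = LinearMap.ker (Module.Dual.eval ℝ V (n α)) := by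
    refine Submodule.eq_of_le_of_finrank_eq (vectorSpan_le_ker fun η hη => (hα hη).2) ?_
    have := finrank_ker_eval hnα
    omega
  obtain ⟨ζ, hζ⟩ := hne
  have hconst : ∀ ζ' ∈ F, ζ' x = ζ x := by
    intro ζ' hζ'
    rw [hF] at hζ hζ'
    exact le_antisymm (hζ'.2 _ hζ.1) (hζ.2 _ hζ'.1)
  have hle : LinearMap.ker (Module.Dual.eval ℝ V (n α))
      ≤ LinearMap.ker (Module.Dual.eval ℝ V x) := hspan ▸ vectorSpan_le_ker hconst
  have hζα := (hα hζ).2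
  have hdiff : (η - ζ) (n α) = 0 := by simp [hη.2, hζα]
  have hx0 : (η - ζ) x = 0 := hle (x := η - ζ) hdiff
  have hηx : η x = ζ x := sub_eq_zero.1 hx0
  rw [hF] at hζ ⊢
  exact ⟨hη.1, fun η' hη' => hηx ▸ hζ.2 η' hη'⟩

/-- A nonzero functional `v` killing the sharp normals would make `η` the midpoint of two distinct
points `η ± t • v` of the polyhedron. -/
theorem span_active_eq_top_of_extreme [FiniteDimensional ℝ V] {η : Module.Dual ℝ V}
    (hη : η ∈ Set.extremePoints ℝ (polyhedron n c)) :
    Submodule.span ℝ (Set.range fun α : active n c η => n α) = ⊤ := by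
  by_contra hne
  obtain ⟨v, hv0, hv⟩ := Submodule.exists_dual_map_eq_bot_of_lt_top (lt_top_iff_ne_top.2 hne)
    inferInstance
  have hv' : ∀ α ∈ active n c η, v (n α) = 0 := by
    intro α hα
    have : v (n α) ∈ Submodule.map v (Submodule.span ℝ (Set.range fun α : active n c η => n α)) :=
      ⟨n α, Submodule.subset_span ⟨⟨α, hα⟩, rfl⟩, rfl⟩
    rw [hv] at this
    exact this
  obtain ⟨t, ht, h1, h2⟩ := exists_add_smul_mem hη.1 hv'
  have hmid : η ∈ openSegment ℝ (η + t • v) (η - t • v) :=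
    ⟨1 / 2, 1 / 2, by norm_num, by norm_num, by norm_num, by module⟩
  have := hη.2 h1 h2 hmid
  rw [add_eq_left] at this
  exact hv0 ((smul_eq_zero.1 this).resolve_left ht.ne')

theorem ncard_active_of_extreme [FiniteDimensional ℝ V]
    (hli : ∀ η ∈ polyhedron n c, LinearIndependent ℝ (fun α : active n c η => n α))
    {η : Module.Dual ℝ V} (hη : η ∈ Set.extremePoints ℝ (polyhedron n c)) :
    (active n c η).ncard = Module.finrank ℝ V := by
  rw [Module.finrank_eq_nat_card_basis
    (Module.Basis.mk (hli η hη.1) (span_active_eq_top_of_extreme hη).ge)]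
  rfl

/-- The points of the polyhedron whose sharp constraints span `V`. -/
def vertices (n : Fin d → V) (c : Fin d → ℝ) : Set (Module.Dual ℝ V) :=
  {η ∈ polyhedron n c | Submodule.span ℝ (n '' active n c η) = ⊤}

/-- A vertex is determined by its set of sharp constraints, since their normals span. -/
theorem finite_vertices : (vertices n c).Finite := by
  refine Set.Finite.of_injOn (f := active n c) (t := Set.univ) (fun _ _ => Set.mem_univ _) ?_
    Set.finite_univ
  intro η hη η' hη' h
  refine LinearMap.ext_on_range (v := fun α : active n c η => n α)
    (by rw [← Set.image_eq_range]; exact hη.2) fun α => ?_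
  have h1 : η (n α) = -c α := α.2
  have h2 : η' (n α) = -c α := by
    have : (α : Fin d) ∈ active n c η' := h ▸ α.2
    exact this
  rw [h1, h2]

/-- From `η`, in a direction in which some constraint decreases and the sharp ones are constant, one
reaches a point with a new sharp constraint. -/
theorem exists_hit {η v : Module.Dual ℝ V} (hη : η ∈ polyhedron n c)
    (hv : ∀ α ∈ active n c η, v (n α) = 0) (hneg : ∃ α, v (n α) < 0) :
    ∃ t > (0 : ℝ), η + t • v ∈ polyhedron n c ∧ active n c η ⊂ active n c (η + t • v) := by
  classical
  let S : Finset (Fin d) := Finset.univ.filter fun α => v (n α) < 0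
  have hS : S.Nonempty := by
    obtain ⟨α, hα⟩ := hneg
    exact ⟨α, by simp [S, hα]⟩
  -- Among the decreasing constraints, `β` is one that becomes sharp first; the ratio is the time at
  -- which this happens.
  obtain ⟨β, hβ, hmin⟩ := S.exists_min_image (fun α => (η (n α) + c α) / (-v (n α))) hS
  have hβ' : v (n β) < 0 := by simpa [S] using hβ
  have hβa : β ∉ active n c η := fun h => hβ'.ne (hv β h)
  have hβl := lt_of_mem_polyhedron hη hβa
  set t := (η (n β) + c β) / (-v (n β)) with ht
  have ht0 : 0 < t := div_pos (by linarith) (by linarith)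
  refine ⟨t, ht0, fun α => ?_, ?_⟩
  · simp only [LinearMap.add_apply, LinearMap.smul_apply, smul_eq_mul]
    by_cases hα : v (n α) < 0
    · have := hmin α (by simp [S, hα])
      rw [le_div_iff₀ (by linarith)] at this
      linarith
    · have := mul_nonneg ht0.le (not_lt.1 hα)
      linarith [hη α]
  · rw [Set.ssubset_iff_of_subset]
    · refine ⟨β, ?_, hβa⟩
      change (η + t • v) (n β) = -c β
      have : t * (-v (n β)) = η (n β) + c β := div_mul_cancel₀ _ (by linarith)
      simp only [LinearMap.add_apply, LinearMap.smul_apply, smul_eq_mul]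
      linarith
    · intro α hα
      have h1 : η (n α) = -c α := hα
      change (η + t • v) (n α) = -c α
      simp [hv α hα, h1]

/-- A polyhedron without directions of recession is the convex hull of its vertices. -/
theorem polyhedron_eq_convexHull [FiniteDimensional ℝ V]
    (hrec : ∀ v : Module.Dual ℝ V, (∀ α, 0 ≤ v (n α)) → v = 0) :
    polyhedron n c = convexHull ℝ (vertices n c) := by
  refine subset_antisymm ?_ (convexHull_min (fun η hη => hη.1) convex_polyhedron)
  -- Induction on the number of slack constraints. From a point that is not a vertex, a line along
  -- which the sharp constraints stay sharp meets further constraints in both directions, and the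
  -- point lies between the two hits.
  suffices H : ∀ k : ℕ, ∀ η ∈ polyhedron n c, d - (active n c η).ncard = k →
      η ∈ convexHull ℝ (vertices n c) from fun η hη => H _ η hη rfl
  intro k
  induction k using Nat.strong_induction_on with
  | _ k ih =>
    intro η hη hk
    by_cases hspan : Submodule.span ℝ (n '' active n c η) = ⊤
    · exact subset_convexHull ℝ _ ⟨hη, hspan⟩
    obtain ⟨v, hv0, hv⟩ := Submodule.exists_dual_map_eq_bot_of_lt_top (lt_top_iff_ne_top.2 hspan)
      inferInstance
    have hv' : ∀ α ∈ active n c η, v (n α) = 0 := by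
      intro α hα
      have : v (n α) ∈ Submodule.map v (Submodule.span ℝ (n '' active n c η)) :=
        ⟨n α, Submodule.subset_span ⟨α, hα, rfl⟩, rfl⟩
      rw [hv] at this
      exact this
    have step : ∀ w : Module.Dual ℝ V, w ≠ 0 → (∀ α ∈ active n c η, w (n α) = 0) →
        ∃ t > (0 : ℝ), η + t • w ∈ convexHull ℝ (vertices n c) := by
      intro w hw0 hw
      have hneg : ∃ α, w (n α) < 0 := by
        by_contra! h
        exact hw0 (hrec w h)
      obtain ⟨t, ht, hmem, hss⟩ := exists_hit hη hw hneg
      refine ⟨t, ht, ih _ ?_ _ hmem rfl⟩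
      have h1 := Set.ncard_lt_ncard hss (Set.toFinite _)
      have h2 : (active n c (η + t • w)).ncard ≤ d := by
        simpa using Set.ncard_le_card (active n c (η + t • w))
      omega
    obtain ⟨t, ht, h1⟩ := step v hv0 hv'
    obtain ⟨s, hs, h2⟩ := step (-v) (neg_ne_zero.2 hv0) fun α hα => by simp [hv' α hα]
    have hts : 0 < t + s := by positivity
    have := (convex_convexHull ℝ (vertices n c)) h1 h2 (a := s / (t + s)) (b := t / (t + s))
      (by positivity) (by positivity) (by field_simp; ring)
    convert this using 1
    ext x
    simp only [LinearMap.add_apply, LinearMap.smul_apply, LinearMap.neg_apply, smul_eq_mul]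
    field_simp
    ring

theorem vertices_nonempty [FiniteDimensional ℝ V] (hne : (polyhedron n c).Nonempty)
    (hrec : ∀ v : Module.Dual ℝ V, (∀ α, 0 ≤ v (n α)) → v = 0) : (vertices n c).Nonempty := by
  rw [polyhedron_eq_convexHull hrec] at hne
  exact convexHull_nonempty_iff.1 hne

end Polyhedron

/-! ### Polyhedra in `𝔱^∨` as stacky polytopes -/

theorem finrank_TSpace (N : Type) [AddCommGroup N] :
    Module.finrank ℝ (TSpace N) = Module.finrank ℤ N :=
  (TensorProduct.isBaseChange ℤ N ℝ).finrank_eq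

/-- A nonempty polyhedron in `𝔱^∨` without directions of recession whose sharp constraints are
linearly independent at each of its points is a stacky polytope. -/
theorem isStackyPolytope_polyhedron {N : Type} [AddCommGroup N] {d : ℕ} {β : (Fin d → ℤ) →+ N}
    (hβ : Function.Surjective β) {c : Fin d → ℝ} (hne : (polyhedron (nbar β) c).Nonempty)
    (hli : ∀ η ∈ polyhedron (nbar β) c,
      LinearIndependent ℝ (fun α : active (nbar β) c η => nbar β α))
    (hrec : ∀ v : TDual N, (∀ α, 0 ≤ v (nbar β α)) → v = 0) :
    IsStackyPolytope β (polyhedron (nbar β) c) (polyFace (nbar β) c) := by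
  have hfin : Module.Finite ℤ N := Module.Finite.of_surjective β.toIntLinearMap hβ
  have hfacet : ∀ α, (polyFace (nbar β) c α).Nonempty →
      IsFacet (polyhedron (nbar β) c) (polyFace (nbar β) c α) := fun α hα =>
    ⟨⟨nbar β α, polyFace_eq_minimizers hα⟩, hα, by
      rw [vectorSpan_polyFace hli hα]
      exact finrank_ker_eval (ne_zero_of_polyFace_nonempty hli hα)⟩
  have hlisted : ∀ F', IsFacet (polyhedron (nbar β) c) F' →
      ∃! α, polyFace (nbar β) c α = F' := by
    rintro F' ⟨⟨x, hx⟩, hF', hdim⟩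
    obtain ⟨α, rfl⟩ := exists_eq_polyFace hne hli hx hF' hdim
    exact ⟨α, rfl, fun α' h => eq_of_polyFace_subset hli hF' h.ge⟩
  refine ⟨hfin, ⟨_, finite_vertices, vertices_nonempty hne hrec, polyhedron_eq_convexHull hrec⟩,
    vectorSpan_polyhedron hne hli, fun α => ?_, hlisted, fun v hv => ?_, fun α hα =>
    ⟨ne_zero_of_polyFace_nonempty hli hα, polyFace_eq_minimizers hα⟩, ?_⟩
  · rcases Set.eq_empty_or_nonempty (polyFace (nbar β) c α) with h | h
    exacts [Or.inr h, Or.inl (hfacet α h)]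
  -- The facets through `v` correspond bijectively to the sharp constraints at `v`, whose normals
  -- form a basis of `𝔱` at a vertex.
  · have himg : {F' | IsFacet (polyhedron (nbar β) c) F' ∧ v ∈ F'}
        = polyFace (nbar β) c '' active (nbar β) c v := by
      ext F'
      constructor
      · rintro ⟨h, hv'⟩
        obtain ⟨α, rfl, -⟩ := hlisted F' h
        exact ⟨α, hv'.2, rfl⟩
      · rintro ⟨α, hα, rfl⟩
        exact ⟨hfacet α ⟨v, hv.1, hα⟩, hv.1, hα⟩
    rw [himg, Set.InjOn.ncard_image, ncard_active_of_extreme hli hv, finrank_TSpace]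
    intro α hα α' hα' h
    exact (eq_of_polyFace_subset hli ⟨v, hv.1, hα⟩ h.le).symm
  · have : β.range = ⊤ := AddMonoidHom.range_eq_top.2 hβ
    rw [this]
    exact inferInstance

/-! ### Homomorphisms into quotients of vector spaces by lattices -/

section Lift

theorem isDiscrete_ker_of_isLocalHomeomorph {V : Type*} [NormedAddCommGroup V]
    {H : Type*} [AddCommGroup H] [TopologicalSpace H] {e : V →+ H} (he : IsLocalHomeomorph e) :
    IsDiscrete (e.ker : Set V) := by
  rw [isDiscrete_iff_forall_mem_exists_isOpen]
  intro y hy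
  obtain ⟨φ, hφ, heφ⟩ := he y
  refine ⟨φ.source, φ.open_source, Set.eq_singleton_iff_unique_mem.2 ⟨⟨hφ, hy⟩, ?_⟩⟩
  rintro x ⟨hx, hxk⟩
  refine φ.injOn hx hφ ?_
  rw [← heφ]
  exact (AddMonoidHom.mem_ker.1 hxk).trans (AddMonoidHom.mem_ker.1 hy).symm
variable {V : Type*} [NormedAddCommGroup V] [NormedSpace ℝ V]
  {W : Type*} [NormedAddCommGroup W] [NormedSpace ℝ W]
  {H : Type*} [AddCommGroup H] [TopologicalSpace H]

/-- A continuous homomorphism from a vector space to `V / Γ`, with `Γ` discrete, is induced by a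
linear map. -/
theorem exists_linear_lift {e : V →+ H} (he : IsLocalHomeomorph e) (hs : Function.Surjective e)
    (f : W →+ H) (hf : Continuous f) : ∃ L : W →L[ℝ] V, ∀ w, e (L w) = f w := by
  -- A quotient by a discrete subgroup is a covering, so `f` lifts through it from the simply
  -- connected space `W`.
  have hcov : IsCoveringMap e :=
    ((he.isOpenMap.isQuotientMap he.continuous hs).isAddQuotientCoveringMap_of_isDiscrete_ker_addMonoidHom
      (isDiscrete_ker_of_isLocalHomeomorph he)).isCoveringMap
  obtain ⟨F, ⟨hF0, hF⟩, -⟩ := hcov.existsUnique_continuousMap_lifts (⟨f, hf⟩ : C(W, H)) 0 0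
    (by simp)
  have hFa : ∀ w, e (F w) = f w := fun w => congrFun hF w
  -- Both sides lift the same map on the connected space `W × W` and agree at the origin. A
  -- continuous additive map of real vector spaces is then linear.
  have hadd : (fun p : W × W => F (p.1 + p.2)) = fun p => F p.1 + F p.2 := by
    refine (T2Space.isSeparatedMap e).eq_of_comp_eq he.isLocallyInjective (by fun_prop)
      (by fun_prop) ?_ (0, 0) (by simp [hF0])
    funext p
    simp [hFa]
  let A : W →+ V := ⟨⟨F, hF0⟩, fun x y => congrFun hadd (x, y)⟩
  exact ⟨A.toRealLinearMap F.continuous, hFa⟩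

end Lift

/-! ### Smoothness through local diffeomorphisms -/

section LocalDiffeo

variable {V : Type*} [NormedAddCommGroup V] [NormedSpace ℝ V]
  {W : Type*} [NormedAddCommGroup W] [NormedSpace ℝ W]
  {W' : Type*} [NormedAddCommGroup W'] [NormedSpace ℝ W']
  {M : Type*} [TopologicalSpace M] [ChartedSpace V M]
  {M' : Type*} [TopologicalSpace M'] [ChartedSpace W M']
  {M'' : Type*} [TopologicalSpace M''] [ChartedSpace W' M'']

/-- Smoothness can be tested after composition with a surjective local diffeomorphism. -/
theorem contMDiff_of_comp_isLocalDiffeomorph {e : M → M'}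
    (he : IsLocalDiffeomorph 𝓘(ℝ, V) 𝓘(ℝ, W) ∞ e) (hs : Function.Surjective e) {f : M' → M''}
    (hf : ContMDiff 𝓘(ℝ, V) 𝓘(ℝ, W') ∞ (f ∘ e)) : ContMDiff 𝓘(ℝ, W) 𝓘(ℝ, W') ∞ f := by
  intro y
  obtain ⟨x, rfl⟩ := hs y
  have h1 := (hf _).comp (e x) (he x).localInverse_contMDiffAt
  refine h1.congr_of_eventuallyEq ?_
  filter_upwards [(he x).localInverse_eventuallyEq_right] with z hz
  have hz' : e ((he x).localInverse z) = z := hz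
  simp [hz']

variable {H : Type*} [AddCommGroup H] [TopologicalSpace H] [IsTopologicalAddGroup H]

/-- Near `v`, the identity `e w = e v + e (w - v)` presents `e` as the inverse of the chart at `e v`
after a translation. -/
theorem isLocalDiffeomorph_exp {e : V →+ H} (he : IsLocalHomeomorph e) :
    let _ := expChartedSpace he
    IsLocalDiffeomorph 𝓘(ℝ, V) 𝓘(ℝ, V) ∞ e := by
  let _ := expChartedSpace he
  have hLie : LieAddGroup 𝓘(ℝ, V) ∞ H := expLieAddGroup he ∞
  have hman : IsManifold 𝓘(ℝ, V) ∞ H := hLie.toIsManifold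
  intro _ v
  let c := chartAt V (e v)
  have hc : ∀ w, c.symm w = e v + e w := by
    intro w
    have : c.symm w = - -(e v) + e w := by
      rw [← congrFun (he.localInverseAt_symm 0) w]; rfl
    rw [this, neg_neg]
  have hcv : c (e v) = 0 := by
    have h1 : c (e v) = he.localInverseAt 0 (-e v + e v) := rfl
    have h2 : he.localInverseAt 0 (e 0) = 0 := he.localInverseAt_apply_self
    rw [h1, neg_add_cancel, ← map_zero e, h2]
  let φ := (Homeomorph.addRight (-v)).toOpenPartialHomeomorph.trans c.symm
  have hφs : ∀ w, w ∈ φ.source ↔ w + -v ∈ c.target := fun w => by simp [φ]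
  refine ⟨{ toPartialEquiv := φ.toPartialEquiv, open_source := φ.open_source,
            open_target := φ.open_target, contMDiffOn_toFun := ?_, contMDiffOn_invFun := ?_ },
    ?_, ?_⟩
  · refine (contMDiffOn_chart_symm (I := 𝓘(ℝ, V)) (x := e v)).comp
      (t := c.target) (g := c.symm) (f := fun w : V => w + -v) ?_ fun w hw => (hφs w).1 hw
    exact ContMDiff.contMDiffOn (contMDiff_id.add contMDiff_const)
  · have h1 : ContMDiffOn 𝓘(ℝ, V) 𝓘(ℝ, V) ∞ c φ.target :=
      (contMDiffOn_chart (I := 𝓘(ℝ, V)) (x := e v)).mono fun w hw => by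
        have := hw.1
        simpa using this
    exact h1.add contMDiffOn_const
  · change v ∈ φ.source
    rw [hφs, add_neg_cancel, ← hcv]
    exact c.map_source (mem_chart_source V (e v))
  · intro w _
    change e w = c.symm (w + -v)
    rw [hc, ← map_add]
    congr 1
    abel

end LocalDiffeo

/-! ### The exponential map of a torus -/

section Torus

variable {E : Type} [NormedAddCommGroup E] [NormedSpace ℝ E]
  {G : Type} [AddCommGroup G] [TopologicalSpace G] [ChartedSpace E G]

variable (E G) in
/-- A torus presented by its exponential map and a basis of its integral lattice. -/
structure TorusExp where
  k : ℕ
  basis : Module.Basis (Fin k) ℝ E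
  ex : E →+ G
  surjective : Function.Surjective ex
  isLocalDiffeomorph : IsLocalDiffeomorph 𝓘(ℝ, E) 𝓘(ℝ, E) ∞ ex
  mfderiv_zero : ∀ ξ : E, (mfderiv 𝓘(ℝ, E) 𝓘(ℝ, E) ex 0 ξ : E) = ξ
  ex_eq_zero_iff : ∀ ξ, ex ξ = 0 ↔ ξ ∈ Submodule.span ℤ (Set.range basis)

/-- The covering homomorphism in the definition of a torus may have any invertible derivative `D` at
zero. Precomposing with `D⁻¹` normalizes it to the exponential map and moves the lattice basis by
`D`. -/
theorem IsTorus.nonempty_torusExp (hG : IsTorus E G) : Nonempty (TorusExp E G) := by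
  obtain ⟨k, b, p, hs, hp, hk⟩ := hG
  let D : E ≃L[ℝ] E := (hp 0).mfderivToContinuousLinearEquiv (by simp)
  have hD : ∀ ξ : E, (mfderiv 𝓘(ℝ, E) 𝓘(ℝ, E) p 0 ξ : E) = D ξ := fun ξ => rfl
  let ex : E →+ G := p.comp D.symm.toLinearEquiv.toAddEquiv.toAddMonoidHom
  have hex : ∀ ξ, ex ξ = p (D.symm ξ) := fun ξ => rfl
  have hdsymm : IsLocalDiffeomorph 𝓘(ℝ, E) 𝓘(ℝ, E) ∞ D.symm := D.symm.toDiffeomorph.isLocalDiffeomorph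
  refine ⟨⟨k, b.map D.toLinearEquiv, ex, hs.comp D.symm.surjective, fun ξ => ?_, fun ξ => ?_,
    fun ξ => ?_⟩⟩
  · exact (hdsymm ξ).comp (hg := hp _)
  · have h1 : MDifferentiableAt 𝓘(ℝ, E) 𝓘(ℝ, E) p (D.symm 0) := by
      rw [map_zero]; exact (hp 0).mdifferentiableAt (by simp)
    have h2 := mfderiv_comp_apply (I := 𝓘(ℝ, E)) (I' := 𝓘(ℝ, E)) (I'' := 𝓘(ℝ, E)) (0 : E) h1
      ((hdsymm 0).mdifferentiableAt (by simp)) ξ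
    have h3 : (mfderiv 𝓘(ℝ, E) 𝓘(ℝ, E) D.symm (0 : E) ξ : E) = D.symm ξ := by
      rw [mfderiv_eq_fderiv]
      exact DFunLike.congr_fun D.symm.fderiv ξ
    refine h2.trans ?_
    -- The type of the derivative depends on the base point, and `D.symm 0` is only provably zero,
    -- so the base point is replaced through a variable.
    have h4 : ∀ x : E, x = 0 → ∀ ζ : E, (mfderiv 𝓘(ℝ, E) 𝓘(ℝ, E) p x ζ : E) = D ζ := by
      rintro _ rfl ζ; rfl
    refine (h4 _ (map_zero _) _).trans ?_
    exact (congrArg D h3).trans (D.apply_symm_apply ξ)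
  · have h1 : ex ξ = 0 ↔ D.symm ξ ∈ (p.ker : Set E) := Iff.rfl
    rw [h1, hk]
    have h2 : Set.range (b.map D.toLinearEquiv)
        = D.toLinearEquiv.toAddEquiv.toAddMonoidHom.toIntLinearMap '' Set.range b := by
      rw [← Set.range_comp]; rfl
    rw [h2, ← Submodule.map_span]
    constructor
    · intro h
      exact ⟨_, h, D.apply_symm_apply ξ⟩
    · rintro ⟨x, hx, rfl⟩
      change D.symm (D x) ∈ _
      rwa [D.symm_apply_apply]

namespace TorusExp

variable (T : TorusExp E G)

theorem contMDiff : ContMDiff 𝓘(ℝ, E) 𝓘(ℝ, E) ∞ T.ex := T.isLocalDiffeomorph.contMDiff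

theorem isLocalHomeomorph : IsLocalHomeomorph T.ex := T.isLocalDiffeomorph.isLocalHomeomorph

theorem finiteDimensional (T : TorusExp E G) : FiniteDimensional ℝ E :=
  Module.Finite.of_basis T.basis

theorem velocity_comp (L : ℝ →L[ℝ] E) :
    velocity E (T.ex.comp L.toLinearMap.toAddMonoidHom) = L 1 := by
  have h1 : MDifferentiableAt 𝓘(ℝ, E) 𝓘(ℝ, E) T.ex (L 0) :=
    T.contMDiff.mdifferentiableAt (by simp)
  have h2 := mfderiv_comp_apply (I := 𝓘(ℝ, ℝ)) (I' := 𝓘(ℝ, E)) (I'' := 𝓘(ℝ, E)) (0 : ℝ) h1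
    L.differentiableAt.mdifferentiableAt 1
  have h3 : (mfderiv 𝓘(ℝ, ℝ) 𝓘(ℝ, E) L (0 : ℝ) (1 : ℝ) : E) = L 1 := by
    rw [mfderiv_eq_fderiv]
    exact DFunLike.congr_fun L.fderiv 1
  have h4 : ∀ x : E, x = 0 → ∀ ζ : E, (mfderiv 𝓘(ℝ, E) 𝓘(ℝ, E) T.ex x ζ : E) = ζ := by
    rintro _ rfl ζ; exact T.mfderiv_zero ζ
  exact h2.trans ((h4 _ (map_zero _) _).trans h3)

/-- A one-parameter subgroup lifts to a linear path in `E`, whose direction is its velocity because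
`T.ex` has identity derivative at zero. -/
theorem isExp_iff {ξ : E} {g : G} : IsExp ξ g ↔ T.ex ξ = g := by
  constructor
  · rintro ⟨γ, hγ, rfl, rfl⟩
    obtain ⟨L, hL⟩ := exists_linear_lift T.isLocalHomeomorph T.surjective γ hγ.continuous
    have : γ = T.ex.comp L.toLinearMap.toAddMonoidHom := AddMonoidHom.ext fun t => (hL t).symm
    rw [this, T.velocity_comp]
    rfl
  · rintro rfl
    let L : ℝ →L[ℝ] E := ContinuousLinearMap.toSpanSingleton ℝ ξ
    have hL : L 1 = ξ := by simp [L]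
    refine ⟨T.ex.comp L.toLinearMap.toAddMonoidHom, ?_, ?_, ?_⟩
    · exact T.contMDiff.comp L.contDiff.contMDiff
    · rw [T.velocity_comp, hL]
    · change T.ex (L 1) = _
      rw [hL]

theorem mem_expKer [LieAddGroup 𝓘(ℝ, E) ∞ G] {ξ : E} :
    ξ ∈ expKer E G ↔ ξ ∈ Submodule.span ℤ (Set.range T.basis) := by
  rw [← T.ex_eq_zero_iff, ← T.isExp_iff]; rfl

variable {d : ℕ} (ρ : G →ₜ+ (Fin d → UnitAddCircle))

theorem charFun_ex {α : Fin d} {R : E →L[ℝ] ℝ}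
    (hR : ∀ ξ, ((R ξ : ℝ) : UnitAddCircle) = ρ (T.ex ξ) α) (ξ : E) :
    charFun ρ α (T.ex ξ) = Complex.exp ((2 * Real.pi * R ξ : ℝ) * Complex.I) := by
  rw [charFun, ← hR, AddCircle.toCircle_apply_mk, Circle.coe_exp]
  simp

theorem exists_weight_lift (α : Fin d) :
    ∃ R : E →L[ℝ] ℝ, ∀ ξ, ((R ξ : ℝ) : UnitAddCircle) = ρ (T.ex ξ) α := by
  let f : E →+ UnitAddCircle :=
    (Pi.evalAddMonoidHom (fun _ : Fin d => UnitAddCircle) α).comp (ρ.toAddMonoidHom.comp T.ex)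
  have hf : Continuous f :=
    (continuous_apply α).comp (ρ.continuous_toFun.comp T.contMDiff.continuous)
  exact exists_linear_lift (e := QuotientAddGroup.mk' (AddSubgroup.zmultiples (1 : ℝ)))
    (AddCircle.isLocalHomeomorph_coe 1) (QuotientAddGroup.mk'_surjective _) f hf

/-- Continuity of `ρ` is enough: on the Lie algebra the character becomes `e^{2πi R}` with `R`
linear. -/
theorem contMDiff_charFun (T : TorusExp E G) (α : Fin d) : ContMDiff 𝓘(ℝ, E) 𝓘(ℝ, ℂ) ∞ (charFun ρ α) := by
  obtain ⟨R, hR⟩ := T.exists_weight_lift ρ α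
  refine contMDiff_of_comp_isLocalDiffeomorph T.isLocalDiffeomorph T.surjective ?_
  have : charFun ρ α ∘ T.ex = fun ξ => Complex.exp ((2 * Real.pi * R ξ : ℝ) * Complex.I) :=
    funext (T.charFun_ex ρ hR)
  rw [this]
  refine ContDiff.contMDiff ?_
  have h1 : ContDiff ℝ ∞ fun ξ => ((2 * Real.pi * R ξ : ℝ) : ℂ) :=
    Complex.ofRealCLM.contDiff.comp (contDiff_const.mul R.contDiff)
  exact (h1.mul contDiff_const).cexp

/-- The chain rule at zero gives `2πi R` as the differential of the character; taking the imaginary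
part and dividing by `2π` recovers `R`. -/
theorem weight_eq {α : Fin d} {R : E →L[ℝ] ℝ}
    (hR : ∀ ξ, ((R ξ : ℝ) : UnitAddCircle) = ρ (T.ex ξ) α) : weight ρ α = R := by
  ext ξ
  have h1 : MDifferentiableAt 𝓘(ℝ, E) 𝓘(ℝ, ℂ) (charFun ρ α) (T.ex 0) :=
    (T.contMDiff_charFun ρ α).mdifferentiableAt (by simp)
  have h2 := mfderiv_comp_apply (I := 𝓘(ℝ, E)) (I' := 𝓘(ℝ, E)) (I'' := 𝓘(ℝ, ℂ)) (0 : E) h1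
    (T.contMDiff.mdifferentiableAt (by simp)) ξ
  have h4 : ∀ x : G, x = 0 → ∀ ζ : E,
      (mfderiv 𝓘(ℝ, E) 𝓘(ℝ, ℂ) (charFun ρ α) x ζ : ℂ) = dChar ρ α ζ := by
    rintro _ rfl ζ; rfl
  have h5 : dChar ρ α ξ = (mfderiv 𝓘(ℝ, E) 𝓘(ℝ, ℂ) (charFun ρ α ∘ T.ex) (0 : E) ξ : ℂ) := by
    refine ((h4 _ (map_zero _) _).symm.trans ?_).trans h2.symm
    exact congrArg _ (T.mfderiv_zero ξ).symm
  have h6 : charFun ρ α ∘ T.ex = fun ξ => Complex.exp ((2 * Real.pi * R ξ : ℝ) * Complex.I) :=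
    funext (T.charFun_ex ρ hR)
  have h7 : HasFDerivAt (fun ξ : E => ((2 * Real.pi * R ξ : ℝ) : ℂ) * Complex.I)
      ((Complex.ofRealCLM.comp ((2 * Real.pi) • R)).smulRight Complex.I) 0 := by
    have := (Complex.ofRealCLM.comp ((2 * Real.pi) • R)).hasFDerivAt (x := (0 : E))
    exact this.mul_const' Complex.I
  have h8 := h7.cexp.fderiv
  rw [h6, mfderiv_eq_fderiv] at h5
  have h9 := h5.trans (DFunLike.congr_fun h8 ξ)
  rw [weight_apply, h9]
  have := Real.pi_ne_zero
  simp
  field_simp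

theorem coe_weight (α : Fin d) (ξ : E) :
    ((weight ρ α ξ : ℝ) : UnitAddCircle) = ρ (T.ex ξ) α := by
  obtain ⟨R, hR⟩ := T.exists_weight_lift ρ α
  rw [T.weight_eq ρ hR, hR]

end TorusExp

end Torus

/-! ### Regular values of the moment map -/

section Moment

variable {E : Type} [NormedAddCommGroup E] [NormedSpace ℝ E]
  {G : Type} [AddCommGroup G] [TopologicalSpace G] [ChartedSpace E G]
  {d : ℕ} {ρ : G →ₜ+ (Fin d → UnitAddCircle)}

theorem momentMap_apply (z : Fin d → ℂ) (ξ : E) :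
    (momentMap ρ z : E →L[ℝ] ℝ) ξ = ∑ α, (Real.pi * ‖z α‖ ^ 2) * weight ρ α ξ := by
  simp [momentMap]

theorem differentiable_momentMap :
    Differentiable ℝ (momentMap ρ : (Fin d → ℂ) → (E →L[ℝ] ℝ)) := by
  unfold momentMap
  refine Differentiable.fun_sum fun α _ => Differentiable.smul_const ?_ _
  exact (Differentiable.norm_sq ℝ (differentiable_apply α)).const_mul _

/-- At a regular point of the moment map, the weights of the nonzero coordinates span. -/
theorem eq_zero_of_fderiv_surjective {z : Fin d → ℂ}
    (hz : Function.Surjective (fderiv ℝ (momentMap ρ : (Fin d → ℂ) → (E →L[ℝ] ℝ)) z)) {ξ : E}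
    (hξ : ∀ α, z α ≠ 0 → weight ρ α ξ = 0) : ξ = 0 := by
  by_contra hne
  obtain ⟨l, hl⟩ := SeparatingDual.exists_ne_zero (R := ℝ) hne
  obtain ⟨v, rfl⟩ := hz l
  apply hl
  have h1 : HasFDerivAt (fun z => (momentMap ρ z : E →L[ℝ] ℝ) ξ)
      ((ContinuousLinearMap.apply ℝ ℝ ξ).comp (fderiv ℝ (momentMap ρ) z)) z :=
    (ContinuousLinearMap.apply ℝ ℝ ξ).hasFDerivAt.comp z
      (differentiable_momentMap z).hasFDerivAt
  -- Every summand of `⟨μ, ξ⟩` has zero derivative at `z`: if `z α = 0` the squared norm is critical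
  -- there, and otherwise the weight kills `ξ`. This contradicts the choice of `v`, whose image
  -- under `dμ` is nonzero on `ξ`.
  have h2 : HasFDerivAt (fun z => (momentMap ρ z : E →L[ℝ] ℝ) ξ)
      (∑ _α : Fin d, (0 : (Fin d → ℂ) →L[ℝ] ℝ)) z := by
    simp only [momentMap_apply]
    refine HasFDerivAt.fun_sum fun α _ => ?_
    by_cases hα : z α = 0
    · have h3 := ((ContinuousLinearMap.proj (R := ℝ) (φ := fun _ : Fin d => ℂ) α).hasFDerivAt
        (x := z)).norm_sq
      have h4 := (h3.const_mul Real.pi).mul_const (weight ρ α ξ)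
      refine h4.congr_fderiv ?_
      ext w
      simp [hα]
    · simp only [hξ α hα, mul_zero]
      exact hasFDerivAt_const _ _
  have h3 := DFunLike.congr_fun (h1.unique h2) v
  simpa using h3

end Moment

/-! ### The polyhedron of the symplectic quotient -/

section Cokernel

variable {N : Type} [AddCommGroup N] {d : ℕ} {β : (Fin d → ℤ) →+ N}

theorem sigmaLin_apply (a : Fin d → ℝ) : sigmaLin β a = ∑ α, a α • nbar β α :=
  Fintype.linearCombination_apply ℝ (nbar β) a

theorem sigmaLin_intCast (a : Fin d → ℤ) :
    sigmaLin β (fun α => (a α : ℝ)) = TensorProduct.tmul ℤ (1 : ℝ) (β a) := by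
  have h1 : β a = ∑ α, a α • β (Pi.single α 1) := by
    conv_lhs => rw [← Finset.univ_sum_single a, map_sum]
    refine Finset.sum_congr rfl fun α _ => ?_
    rw [← map_zsmul, ← Pi.single_smul, smul_eq_mul, mul_one]
  rw [h1, sigmaLin_apply, TensorProduct.tmul_sum]
  refine Finset.sum_congr rfl fun α _ => ?_
  rw [TensorProduct.tmul_smul, nbar, Int.cast_smul_eq_zsmul]

theorem dual_sigmaLin (η : TDual N) (a : Fin d → ℝ) :
    η (sigmaLin β a) = ∑ α, a α * η (nbar β α) := by
  rw [sigmaLin_apply, map_sum]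
  simp

theorem tdual_eq_zero (hβ : Function.Surjective β) {v : TDual N} (hv : ∀ α, v (nbar β α) = 0) :
    v = 0 := by
  refine LinearMap.ext fun x => ?_
  induction x using TensorProduct.induction_on with
  | zero => simp
  | add x y hx hy => rw [map_add, hx, hy]; simp
  | tmul r n =>
    obtain ⟨a, rfl⟩ := hβ n
    have : TensorProduct.tmul ℤ r (β a) = r • TensorProduct.tmul ℤ (1 : ℝ) (β a) := by
      rw [TensorProduct.smul_tmul', smul_eq_mul, mul_one]
    rw [this, map_smul, ← sigmaLin_intCast, dual_sigmaLin]
    simp [hv]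

theorem one_tmul_eq_zero_of_torsion {m : N} {k : ℤ} (hk : k ≠ 0) (h : k • m = 0) :
    TensorProduct.tmul ℤ (1 : ℝ) m = 0 := by
  have hk' : (k : ℝ) ≠ 0 := by exact_mod_cast hk
  have h1 : (1 : ℝ) = k • (k : ℝ)⁻¹ := by rw [zsmul_eq_mul, mul_inv_cancel₀ hk']
  rw [h1, TensorProduct.smul_tmul, h, TensorProduct.tmul_zero]

/-- Modulo torsion `N` is free, so `ℤ^d → N / torsion` splits. Tensoring with `ℝ` kills the torsion,
so the splitting of lattices gives a section of `σ`. -/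
theorem exists_isTorusSection (hβ : Function.Surjective β) : ∃ s, IsTorusSection β s := by
  have hfin : Module.Finite ℤ N := Module.Finite.of_surjective β.toIntLinearMap hβ
  let Tn := Submodule.torsion ℤ N
  have hfree : Module.Free ℤ (N ⧸ Tn) := Module.free_of_finite_type_torsion_free'
  obtain ⟨s₀, hs₀⟩ := Module.projective_lifting_property (Tn.mkQ ∘ₗ β.toIntLinearMap)
    (LinearMap.id : (N ⧸ Tn) →ₗ[ℤ] (N ⧸ Tn)) (Tn.mkQ_surjective.comp hβ)
  let s₁ : N →ₗ[ℤ] (Fin d → ℤ) := s₀ ∘ₗ Tn.mkQ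
  let castL : (Fin d → ℤ) →ₗ[ℤ] (Fin d → ℝ) :=
    (AddMonoidHom.compLeft (Int.castAddHom ℝ) (Fin d)).toIntLinearMap
  let s : TSpace N →ₗ[ℝ] (Fin d → ℝ) := LinearMap.liftBaseChange ℝ (castL ∘ₗ s₁)
  have hs : ∀ n, s (TensorProduct.tmul ℤ (1 : ℝ) n) = fun α => ((s₁ n α : ℤ) : ℝ) := by
    intro n
    simp only [s, LinearMap.liftBaseChange_tmul, one_smul]
    rfl
  have hσ : ∀ n, sigmaLin β (s (TensorProduct.tmul ℤ (1 : ℝ) n))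
      = TensorProduct.tmul ℤ (1 : ℝ) n := by
    intro n
    rw [hs, sigmaLin_intCast, ← sub_eq_zero, ← TensorProduct.tmul_sub]
    have h1 : Tn.mkQ (β (s₁ n) - n) = 0 := by
      have := LinearMap.congr_fun hs₀ (Tn.mkQ n)
      rw [map_sub, sub_eq_zero]
      exact this
    rw [Submodule.mkQ_apply, Submodule.Quotient.mk_eq_zero, Submodule.mem_torsion_iff] at h1
    obtain ⟨k, hk⟩ := h1
    exact one_tmul_eq_zero_of_torsion (nonZeroDivisors.coe_ne_zero k) hk
  have hid : sigmaLin β ∘ₗ s = LinearMap.id := by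
    refine TensorProduct.AlgebraTensorModule.ext fun r n => ?_
    have : TensorProduct.tmul ℤ r n = r • TensorProduct.tmul ℤ (1 : ℝ) n := by
      rw [TensorProduct.smul_tmul', smul_eq_mul, mul_one]
    rw [this, LinearMap.comp_apply, map_smul, map_smul, hσ]
    rfl
  refine ⟨s, fun n α => ⟨s₁ n α, by rw [hs]⟩, fun x => ⟨0, ?_⟩⟩
  rw [TensorProduct.tmul_zero, sub_eq_zero]
  exact LinearMap.congr_fun hid x

/-- A linear map whose values lie in a countable set is zero, so that a section of `σ` up to the
lattice is a section of `σ`. -/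
theorem sigmaLin_section (hβ : Function.Surjective β) {s : TSpace N →ₗ[ℝ] (Fin d → ℝ)}
    (hs : IsTorusSection β s) (x : TSpace N) : sigmaLin β (s x) = x := by
  by_contra hne
  rw [← sub_eq_zero] at hne
  choose n hn using fun t : ℝ => hs.2 (t • x)
  have hN : Countable N := hβ.countable
  have hinj : Function.Injective n := by
    intro t t' h
    have h1 := (hn t).trans ((congrArg _ h).trans (hn t').symm)
    rw [map_smul, map_smul, map_smul, map_smul, ← smul_sub, ← smul_sub] at h1
    exact smul_left_injective ℝ hne h1
  exact not_countable (α := ℝ) hinj.countable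

end Cokernel

/-! ### The level set and the polyhedron, for any surjection `β` with kernel the image of `ρ̇` -/

section Level

variable {E : Type} [NormedAddCommGroup E] [NormedSpace ℝ E]
  {G : Type} [AddCommGroup G] [TopologicalSpace G] [ChartedSpace E G]
  {N : Type} [AddCommGroup N] {d : ℕ} {β : (Fin d → ℤ) →+ N}
  {ρ : G →ₜ+ (Fin d → UnitAddCircle)} {τ : E →L[ℝ] ℝ} {c : Fin d → ℝ}

theorem mem_levelSet_iff (hc : ∑ α, c α • weight ρ α = τ) {z : Fin d → ℂ} :
    z ∈ levelSet ρ τ ↔ ∑ α, (Real.pi * ‖z α‖ ^ 2 - c α) • (weight ρ α : E →L[ℝ] ℝ) = 0 := by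
  have h1 : ∑ α, (Real.pi * ‖z α‖ ^ 2 - c α) • (weight ρ α : E →L[ℝ] ℝ)
      = momentMap ρ z - τ := by
    rw [← hc, momentMap, ← Finset.sum_sub_distrib]
    exact Finset.sum_congr rfl fun α _ => by ext ξ; simp [sub_mul]
  rw [h1, sub_eq_zero]
  rfl

variable [LieAddGroup 𝓘(ℝ, E) ∞ G]

/-- A relation among the weights is a functional on `ℤ^d` that vanishes on the image of `ρ̇`, which
is `ker β`; it descends to `N` and extends linearly to `𝔱`. -/
theorem exists_tdual (hβ : Function.Surjective β) (hker : β.ker = (rhoDot (E := E) ρ).range)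
    {x : Fin d → ℝ} (hx : ∑ α, x α • (weight ρ α : E →L[ℝ] ℝ) = 0) :
    ∃ η : TDual N, ∀ α, η (nbar β α) = x α := by
  let f : (Fin d → ℤ) →+ ℝ := (Fintype.linearCombination ℤ x).toAddMonoidHom
  have hf : ∀ a, f a = ∑ α, (a α : ℝ) * x α := by
    intro a
    simp [f, Fintype.linearCombination_apply]
  have hle : β.ker ≤ f.ker := by
    rw [hker]
    rintro _ ⟨ζ, rfl⟩
    have h := DFunLike.congr_fun hx (ζ : E)
    rw [AddMonoidHom.mem_ker, hf]
    simp only [rhoDot_apply]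
    simpa [mul_comm] using h
  let g : N →+ ℝ := AddMonoidHom.liftOfSurjective β hβ ⟨f, hle⟩
  have hg : ∀ a, g (β a) = f a := fun a =>
    AddMonoidHom.liftOfRightInverse_comp_apply β _ (Function.rightInverse_surjInv hβ) ⟨f, hle⟩ a
  refine ⟨LinearMap.liftBaseChange ℝ g.toIntLinearMap, fun α => ?_⟩
  rw [nbar, LinearMap.liftBaseChange_tmul, one_smul]
  change g _ = _
  rw [hg, hf]
  simp [Pi.single_apply]

/-- The pullback of `η` to `ℤ^d` kills `ker β`, hence the image of `ρ̇`. Since the lattice contains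
a basis of the Lie algebra, the resulting relation holds everywhere. -/
theorem sum_tdual_smul_weight (T : TorusExp E G) (hker : β.ker = (rhoDot (E := E) ρ).range)
    (η : TDual N) : ∑ α, η (nbar β α) • (weight ρ α : E →L[ℝ] ℝ) = 0 := by
  rw [← ContinuousLinearMap.coe_inj]
  refine T.basis.ext fun i => ?_
  have hi : T.basis i ∈ expKer E G := T.mem_expKer.2 (Submodule.subset_span ⟨i, rfl⟩)
  have h1 : β (rhoDot (E := E) ρ ⟨_, hi⟩) = 0 := by
    rw [← AddMonoidHom.mem_ker, hker]
    exact ⟨_, rfl⟩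
  have h2 := dual_sigmaLin (β := β) η fun α => (rhoDot (E := E) ρ ⟨_, hi⟩ α : ℝ)
  rw [sigmaLin_intCast, h1, TensorProduct.tmul_zero, map_zero] at h2
  simp only [rhoDot_apply] at h2
  simp only [ContinuousLinearMap.coe_coe, sum_apply,
    smul_apply, smul_eq_mul]
  simpa [mul_comm] using h2.symm

/-- Exactness of `𝔤 → ℝ^d → 𝔱`, by duality: a functional on `ℝ^d` that kills the image of `𝔤` is a
relation among the weights, so it comes from `𝔱^∨` and kills `a`. -/
theorem exists_weight_eq (hβ : Function.Surjective β) (hker : β.ker = (rhoDot (E := E) ρ).range)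
    {a : Fin d → ℝ} (ha : sigmaLin β a = 0) : ∃ ξ : E, ∀ α, weight ρ α ξ = a α := by
  let W : E →ₗ[ℝ] (Fin d → ℝ) := LinearMap.pi fun α => (weight ρ α : E →L[ℝ] ℝ).toLinearMap
  by_contra! hne
  have hmem : a ∉ LinearMap.range W := by
    rintro ⟨ξ, rfl⟩
    obtain ⟨α, hα⟩ := hne ξ
    exact hα rfl
  obtain ⟨f, hfa, hf⟩ := Submodule.exists_le_ker_of_notMem hmem
  have hfs : ∀ y, f y = ∑ α, y α * f (Pi.single α 1) := by
    intro y
    conv_lhs => rw [← Finset.univ_sum_single y, map_sum]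
    refine Finset.sum_congr rfl fun α _ => ?_
    rw [← smul_eq_mul (y α), ← map_smul, ← Pi.single_smul, smul_eq_mul, mul_one]
  have hx : ∑ α, f (Pi.single α 1) • (weight ρ α : E →L[ℝ] ℝ) = 0 := by
    ext ξ
    have h1 : f (W ξ) = 0 := hf ⟨ξ, rfl⟩
    rw [hfs] at h1
    simpa [W, mul_comm] using h1
  obtain ⟨η, hη⟩ := exists_tdual hβ hker hx
  apply hfa
  have h2 := dual_sigmaLin (β := β) η a
  rw [ha, map_zero] at h2
  simp only [hη] at h2
  rw [hfs, ← h2]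

/-- The inequalities defining the polyhedron allow real square roots to be taken as the coordinates
of `z`. -/
theorem exists_levelSet_of_mem (T : TorusExp E G) (hker : β.ker = (rhoDot (E := E) ρ).range)
    (hc : ∑ α, c α • weight ρ α = τ) {η : TDual N} (hη : η ∈ polyhedron (nbar β) c) :
    ∃ z ∈ levelSet ρ τ, ∀ α, Real.pi * ‖z α‖ ^ 2 = η (nbar β α) + c α := by
  have hz : ∀ α, Real.pi * ‖((√((η (nbar β α) + c α) / Real.pi) : ℝ) : ℂ)‖ ^ 2
      = η (nbar β α) + c α := by
    intro α
    have h1 : 0 ≤ (η (nbar β α) + c α) / Real.pi :=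
      div_nonneg (by linarith [hη α]) Real.pi_pos.le
    rw [Complex.norm_real, Real.norm_eq_abs, sq_abs, Real.sq_sqrt h1]
    exact mul_div_cancel₀ _ Real.pi_ne_zero
  refine ⟨_, ?_, hz⟩
  rw [mem_levelSet_iff hc]
  simp only [hz, add_sub_cancel_right]
  exact sum_tdual_smul_weight T hker η

theorem exists_tdual_of_mem_levelSet (hβ : Function.Surjective β)
    (hker : β.ker = (rhoDot (E := E) ρ).range) (hc : ∑ α, c α • weight ρ α = τ) {z : Fin d → ℂ}
    (hz : z ∈ levelSet ρ τ) :
    ∃ η ∈ polyhedron (nbar β) c, ∀ α, η (nbar β α) = Real.pi * ‖z α‖ ^ 2 - c α := by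
  obtain ⟨η, hη⟩ := exists_tdual hβ hker ((mem_levelSet_iff hc).1 hz)
  refine ⟨η, fun α => ?_, hη⟩
  rw [hη]
  have : 0 ≤ Real.pi * ‖z α‖ ^ 2 := by positivity
  linarith

/-- Evaluate `η` on `x = σ(s x)`: the coordinates of `s x` pair with the numbers `η(n̄_α)`, so the
choice of `s` does not matter. -/
theorem reducedMomentMap_eq (hβ : Function.Surjective β) {s : TSpace N →ₗ[ℝ] (Fin d → ℝ)}
    (hs : IsTorusSection β s) {η : TDual N} {z : Fin d → ℂ}
    (h : ∀ α, η (nbar β α) = Real.pi * ‖z α‖ ^ 2 - c α) : reducedMomentMap c s z = η := by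
  refine LinearMap.ext fun x => ?_
  conv_rhs => rw [← sigmaLin_section hβ hs x, dual_sigmaLin]
  simp [reducedMomentMap, h, mul_comm]

theorem image_reducedMomentMap (T : TorusExp E G) (hβ : Function.Surjective β)
    (hker : β.ker = (rhoDot (E := E) ρ).range) (hc : ∑ α, c α • weight ρ α = τ)
    {s : TSpace N →ₗ[ℝ] (Fin d → ℝ)} (hs : IsTorusSection β s) :
    reducedMomentMap c s '' levelSet ρ τ = polyhedron (nbar β) c := by
  ext η
  constructor
  · rintro ⟨z, hz, rfl⟩
    obtain ⟨η, hη, h⟩ := exists_tdual_of_mem_levelSet hβ hker hc hz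
    rwa [reducedMomentMap_eq hβ hs h]
  · intro hη
    obtain ⟨z, hz, h⟩ := exists_levelSet_of_mem T hker hc hη
    exact ⟨z, hz, reducedMomentMap_eq hβ hs fun α => by rw [h, add_sub_cancel_right]⟩

/-- Extended by zero, a relation `a` among the sharp normals is given by weights evaluated at some
`ξ`. Over `η` the nonzero coordinates of `z` belong to slack constraints, where `a` vanishes, so
regularity forces `ξ = 0`. -/
theorem linearIndependent_active (T : TorusExp E G) (hβ : Function.Surjective β)
    (hker : β.ker = (rhoDot (E := E) ρ).range) (hc : ∑ α, c α • weight ρ α = τ)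
    (h : QuotientHyp ρ τ) {η : TDual N} (hη : η ∈ polyhedron (nbar β) c) :
    LinearIndependent ℝ (fun α : active (nbar β) c η => nbar β α) := by
  classical
  obtain ⟨z, hz, hzη⟩ := exists_levelSet_of_mem T hker hc hη
  rw [Fintype.linearIndependent_iff]
  intro g hg
  let a : Fin d → ℝ := fun α => if hα : α ∈ active (nbar β) c η then g ⟨α, hα⟩ else 0
  have ha : sigmaLin β a = 0 := by
    rw [sigmaLin_apply, ← hg]
    symm
    rw [← Finset.sum_subset (Finset.subset_univ (Finset.univ.filter (· ∈ active (nbar β) c η)))]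
    · rw [Finset.sum_subtype (p := (· ∈ active (nbar β) c η)) _ (by simp)]
      refine Finset.sum_congr rfl fun α _ => ?_
      simp [a]
    · intro α _ hα
      have hα' : α ∉ active (nbar β) c η := by simpa using hα
      simp [a, hα']
  obtain ⟨ξ, hξ⟩ := exists_weight_eq hβ hker ha
  have hξ0 : ξ = 0 := by
    refine eq_zero_of_fderiv_surjective (h.regular z hz) fun α hα => ?_
    have : α ∉ active (nbar β) c η := by
      intro hα'
      have h1 : η (nbar β α) = -c α := hα'
      have h2 := hzη α
      rw [h1, neg_add_cancel, mul_eq_zero, or_iff_right Real.pi_ne_zero] at h2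
      exact hα (by simpa using h2)
    rw [hξ]
    simp [a, this]
  intro α
  have := hξ α
  rw [hξ0, map_zero] at this
  simpa [a] using this.symm

/-- A recession direction with some positive value would give points of the compact level set with
an arbitrarily large coordinate. -/
theorem tdual_eq_zero_of_nonneg (T : TorusExp E G) (hβ : Function.Surjective β)
    (hker : β.ker = (rhoDot (E := E) ρ).range) (hc : ∑ α, c α • weight ρ α = τ)
    (h : QuotientHyp ρ τ) {v : TDual N} (hv : ∀ α, 0 ≤ v (nbar β α)) : v = 0 := by
  refine tdual_eq_zero hβ fun α => ?_
  obtain ⟨z₀, hz₀⟩ := h.nonempty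
  obtain ⟨η, hη, -⟩ := exists_tdual_of_mem_levelSet hβ hker hc hz₀
  have hcpt : IsCompact (levelSet ρ τ) := h.proper.isCompact_preimage isCompact_singleton
  obtain ⟨C, hC⟩ := hcpt.isBounded.exists_norm_le
  by_contra hne
  have hpos : 0 < v (nbar β α) := lt_of_le_of_ne (hv α) (Ne.symm hne)
  have hbound : ∀ t : ℝ, 0 ≤ t → η (nbar β α) + t * v (nbar β α) + c α ≤ Real.pi * C ^ 2 := by
    intro t ht
    have hmem : η + t • v ∈ polyhedron (nbar β) c := by
      intro γ
      have := mul_nonneg ht (hv γ)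
      simp only [LinearMap.add_apply, LinearMap.smul_apply, smul_eq_mul]
      linarith [hη γ]
    obtain ⟨z, hz, hzη⟩ := exists_levelSet_of_mem T hker hc hmem
    have h1 := hzη α
    simp only [LinearMap.add_apply, LinearMap.smul_apply, smul_eq_mul] at h1
    rw [← h1]
    have h2 : ‖z α‖ ≤ C := (norm_le_pi_norm z α).trans (hC z hz)
    have := Real.pi_pos
    gcongr
  have h1 := hη α
  -- At this time the increase alone is `π C² + 1`, which exceeds the bound since `η (nbar β α) + c
  -- α` is nonnegative.
  have h2 : 0 ≤ (Real.pi * C ^ 2 + 1) / v (nbar β α) := by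
    have := Real.pi_pos
    positivity
  have h3 := hbound _ h2
  rw [div_mul_cancel₀ _ hne] at h3
  linarith

theorem isStackyPolytope_of_quotientHyp (T : TorusExp E G) (hβ : Function.Surjective β)
    (hker : β.ker = (rhoDot (E := E) ρ).range) (hc : ∑ α, c α • weight ρ α = τ)
    (h : QuotientHyp ρ τ) :
    IsStackyPolytope β (polyhedron (nbar β) c) (polyFace (nbar β) c) := by
  obtain ⟨z₀, hz₀⟩ := h.nonempty
  obtain ⟨η, hη, -⟩ := exists_tdual_of_mem_levelSet hβ hker hc hz₀
  exact isStackyPolytope_polyhedron hβ ⟨η, hη⟩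
    (fun η hη => linearIndependent_active T hβ hker hc h hη)
    fun v hv => tdual_eq_zero_of_nonneg T hβ hker hc h hv

/-- A lattice vector in the kernel is annihilated by all weights, which regularity at any point of
the level set excludes unless it is zero. -/
theorem rhoDot_injective (h : QuotientHyp ρ τ) :
    Function.Injective (rhoDot (E := E) ρ) := by
  rw [injective_iff_map_eq_zero]
  intro ζ hζ
  obtain ⟨z, hz⟩ := h.nonempty
  refine Subtype.ext (eq_zero_of_fderiv_surjective (h.regular z hz) fun α _ => ?_)
  rw [← rhoDot_apply, hζ]
  simp

end Level

/-! ### The Gale dual of a surjection -/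

namespace ChainLift

variable {M N : Type} [AddCommGroup M] [AddCommGroup N] {β : M →+ N}
  {P : FreeResolution M} {Q : FreeResolution N} (b : ChainLift β P Q)

theorem coneD₁_apply (p : P.X 0) (q : Q.X 1) : b.coneD₁ (p, q) = Q.bd 0 q - b.f 0 p := rfl

theorem coneD₂_apply (p : P.X 1) (q : Q.X 2) :
    b.coneD₂ (p, q) = (-P.bd 0 p, Q.bd 1 q - b.f 1 p) := rfl

theorem aug_f (p : P.X 0) : Q.aug (b.f 0 p) = β (P.aug p) := DFunLike.congr_fun b.comm_aug p

theorem aug_coneD₂ (k : P.X 1 × Q.X 2) : P.aug (b.coneD₂ k).1 = 0 := by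
  rw [coneD₂_apply, map_neg, P.exact_zero.apply_apply_eq_zero, neg_zero]

theorem map_aug_of_coneD₁_eq_zero {k : P.X 0 × Q.X 1} (hk : b.coneD₁ k = 0) :
    β (P.aug k.1) = 0 := by
  have h1 : Q.bd 0 k.2 - b.f 0 k.1 = 0 := hk
  rw [← b.aug_f, ← sub_eq_zero.1 h1, Q.exact_zero.apply_apply_eq_zero]

/-- The augmentation of the first component maps the degree-one homology of the cone to `ker β`.
This is its surjectivity; `exists_boundary` is its injectivity. -/
theorem exists_cycle {x : M} (hx : β x = 0) :
    ∃ k : P.X 0 × Q.X 1, b.coneD₁ k = 0 ∧ P.aug k.1 = x := by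
  obtain ⟨p, rfl⟩ := P.aug_surjective x
  rw [← b.aug_f] at hx
  obtain ⟨q, hq⟩ := (Q.exact_zero _).1 hx
  exact ⟨(p, q), by rw [coneD₁_apply, hq, sub_self], rfl⟩

theorem exists_boundary {k : P.X 0 × Q.X 1} (hk : b.coneD₁ k = 0) (h0 : P.aug k.1 = 0) :
    ∃ l, b.coneD₂ l = k := by
  obtain ⟨p, q⟩ := k
  obtain ⟨p', hp'⟩ := (P.exact_zero _).1 h0
  have h1 : Q.bd 0 (q - b.f 1 p') = 0 := by
    have h2 : b.f 0 (P.bd 0 p') = Q.bd 0 (b.f 1 p') := DFunLike.congr_fun (b.comm 0) p'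
    rw [map_sub, ← h2, hp']
    exact hk
  obtain ⟨q', hq'⟩ := (Q.exact_succ 0 _).1 h1
  refine ⟨(-p', q'), ?_⟩
  rw [coneD₂_apply, map_neg, neg_neg, hp', hq', map_neg, sub_neg_eq_add, sub_add_cancel]

/-- The degree-zero homology of the cone is `coker β`, which vanishes here. -/
theorem coneD₁_surjective (hβ : Function.Surjective β) : Function.Surjective b.coneD₁ := by
  intro q₀
  obtain ⟨m, hm⟩ := hβ (-Q.aug q₀)
  obtain ⟨p, rfl⟩ := P.aug_surjective m
  rw [← b.aug_f] at hm
  obtain ⟨q, hq⟩ := (Q.exact_zero (q₀ + b.f 0 p)).1 (by rw [map_add, hm, add_neg_cancel])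
  exact ⟨(p, q), by rw [coneD₁_apply, hq, add_sub_cancel_right]⟩

/-- If `0 → L → M → N → 0` is exact with `L` free, then `DG(β) ≅ L^∨`, and `β^DG` is the dual of
`L → M`. -/
theorem exists_DG_equiv (hβ : Function.Surjective β) {L : Type} [AddCommGroup L] [Module.Free ℤ L]
    {ι : L →+ M} (hι : Function.Injective ι) (hex : β.ker = ι.range) :
    ∃ e : b.DG ≃+ (L →+ ℤ), ∀ φ : M →+ ℤ, e (b.toDG φ) = φ.comp ι := by
  have hβι : ∀ l, β (ι l) = 0 := fun l => by
    rw [← AddMonoidHom.mem_ker, hex]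
    exact ⟨l, rfl⟩
  let B := Module.Free.chooseBasis ℤ L
  -- Freeness of `L` allows cycles representing `L ≅ ker β` to be chosen additively; `t` is this
  -- choice.
  choose k hk1 hk2 using fun i => b.exists_cycle (hβι (B i))
  let tl : L →ₗ[ℤ] P.X 0 × Q.X 1 := B.constr ℤ k
  let t : L →+ P.X 0 × Q.X 1 := tl.toAddMonoidHom
  have ht1 : ∀ l, b.coneD₁ (t l) = 0 := by
    have : b.coneD₁.toIntLinearMap ∘ₗ tl = 0 := B.ext fun i => by
      simp only [tl, LinearMap.comp_apply, Module.Basis.constr_basis]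
      exact hk1 i
    exact fun l => LinearMap.congr_fun this l
  have ht2 : ∀ l, P.aug (t l).1 = ι l := by
    have : (P.aug.comp (AddMonoidHom.fst _ _)).toIntLinearMap ∘ₗ tl = ι.toIntLinearMap :=
      B.ext fun i => by
        simp only [tl, LinearMap.comp_apply, Module.Basis.constr_basis]
        exact hk2 i
    exact fun l => LinearMap.congr_fun this l
  -- As `Q.X 0` is free, the surjective differential splits, and `π` is the resulting projection
  -- onto the cycles.
  obtain ⟨sl, hsl⟩ := Module.projective_lifting_property b.coneD₁.toIntLinearMap
    (LinearMap.id : Q.X 0 →ₗ[ℤ] Q.X 0) (b.coneD₁_surjective hβ)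
  let s : Q.X 0 →+ P.X 0 × Q.X 1 := sl.toAddMonoidHom
  have hs : ∀ q, b.coneD₁ (s q) = q := fun q => LinearMap.congr_fun hsl q
  let π : P.X 0 × Q.X 1 →+ P.X 0 × Q.X 1 := AddMonoidHom.id _ - s.comp b.coneD₁
  have hπ : ∀ k, π k = k - s (b.coneD₁ k) := fun k => rfl
  have hπ1 : ∀ k, b.coneD₁ (π k) = 0 := fun k => by rw [hπ, map_sub, hs, sub_self]
  let ev : b.cocycles →+ (L →+ ℤ) :=
    { toFun := fun φ => φ.1.comp t
      map_zero' := rfl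
      map_add' := fun _ _ => rfl }
  have hker : ev.ker = b.coboundaries.addSubgroupOf b.cocycles := by
    ext φ
    rw [AddMonoidHom.mem_ker, AddSubgroup.mem_addSubgroupOf]
    constructor
    · intro hφ
      -- Each cycle differs from some `t l` by a boundary, so a cocycle vanishing along `t` vanishes
      -- on all cycles. It then factors through the differential by means of `s`, hence is a
      -- coboundary.
      have h1 : ∀ k, b.coneD₁ k = 0 → φ.1 k = 0 := by
        intro k hk
        obtain ⟨l, hl⟩ : P.aug k.1 ∈ ι.range := hex ▸ b.map_aug_of_coneD₁_eq_zero hk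
        obtain ⟨m, hm⟩ := b.exists_boundary (k := k - t l) (by rw [map_sub, hk, ht1, sub_zero])
          (by rw [Prod.fst_sub, map_sub, ht2, hl, sub_self])
        have h2 : φ.1 (b.coneD₂ m) = 0 := DFunLike.congr_fun φ.2 m
        have h3 : φ.1 (t l) = 0 := DFunLike.congr_fun hφ l
        rwa [hm, map_sub, h3, sub_zero] at h2
      refine ⟨φ.1.comp s, AddMonoidHom.ext fun k => ?_⟩
      have := h1 _ (hπ1 k)
      rwa [hπ, map_sub, sub_eq_zero] at this
    · rintro ⟨ψ, hψ⟩
      refine AddMonoidHom.ext fun l => ?_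
      change φ.1 (t l) = 0
      have : φ.1 (t l) = ψ (b.coneD₁ (t l)) := DFunLike.congr_fun hψ _
      rw [this, ht1, map_zero]
  have hsurj : Function.Surjective ev := by
    intro χ
    -- A retraction for `t`: project to the cycles and take the class in `ker β ≅ L`. It kills
    -- boundaries, so `χ.comp r` is a cocycle restricting to `χ`.
    let r : P.X 0 × Q.X 1 →+ L :=
      (AddMonoidHom.ofInjective hι).symm.toAddMonoidHom.comp
        (((P.aug.comp (AddMonoidHom.fst _ _)).comp π).codRestrict ι.range fun k =>
          hex ▸ b.map_aug_of_coneD₁_eq_zero (hπ1 k))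
    have hr : ∀ k, ι (r k) = P.aug (π k).1 := fun k =>
      congrArg Subtype.val ((AddMonoidHom.ofInjective hι).apply_symm_apply _)
    refine ⟨⟨χ.comp r, AddMonoidHom.ext fun k => ?_⟩, AddMonoidHom.ext fun l => ?_⟩
    · have h1 : r (b.coneD₂ k) = 0 := by
        apply hι
        have h2 : b.coneD₁ (b.coneD₂ k) = 0 := DFunLike.congr_fun b.coneD₁_comp_coneD₂ k
        rw [hr, hπ, h2, map_zero, sub_zero, aug_coneD₂, map_zero]
      change χ (r (b.coneD₂ k)) = 0
      rw [h1, map_zero]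
    · have h1 : r (t l) = l := by
        apply hι
        rw [hr, hπ, ht1, map_zero, sub_zero, ht2]
      change χ (r (t l)) = χ l
      rw [h1]
  refine ⟨(QuotientAddGroup.quotientAddEquivOfEq hker.symm).trans
    (QuotientAddGroup.quotientKerEquivOfSurjective ev hsurj), fun φ => AddMonoidHom.ext fun l => ?_⟩
  change φ (P.aug (t l).1) = φ (ι l)
  rw [ht2]

end ChainLift

/-! ### A torus as the character group of its weight lattice -/

namespace TorusExp

variable {E : Type} [NormedAddCommGroup E] [NormedSpace ℝ E]
  {G : Type} [AddCommGroup G] [TopologicalSpace G] [ChartedSpace E G] [LieAddGroup 𝓘(ℝ, E) ∞ G]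
  (T : TorusExp E G)

/-- The basis of the integral lattice. -/
def latticeBasis : Module.Basis (Fin T.k) ℤ (expKer E G) :=
  (T.basis.restrictScalars ℤ).map (AddEquiv.toIntLinearEquiv
    { toFun := fun x => ⟨x.1, T.mem_expKer.2 x.2⟩
      invFun := fun x => ⟨x.1, T.mem_expKer.1 x.2⟩
      left_inv := fun _ => rfl
      right_inv := fun _ => rfl
      map_add' := fun _ _ => rfl })

theorem coe_latticeBasis (i : Fin T.k) : (T.latticeBasis i : E) = T.basis i :=
  T.basis.restrictScalars_apply ℤ i

/-- The linear functional on the Lie algebra extending an integral functional on the lattice. -/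
def extend : (expKer E G →+ ℤ) →+ (E →ₗ[ℝ] ℝ) where
  toFun χ := T.basis.constr ℝ fun i => (χ (T.latticeBasis i) : ℝ)
  map_zero' := T.basis.ext fun i => by simp
  map_add' χ ψ := T.basis.ext fun i => by simp

theorem extend_basis (χ : expKer E G →+ ℤ) (i : Fin T.k) :
    T.extend χ (T.basis i) = χ (T.latticeBasis i) :=
  T.basis.constr_basis ℝ _ i

theorem extend_apply (χ : expKer E G →+ ℤ) (ζ : expKer E G) : T.extend χ ζ = χ ζ := by
  have h : (T.extend χ).toAddMonoidHom.toIntLinearMap ∘ₗ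
      (expKer E G).subtype.toIntLinearMap = ((Int.castAddHom ℝ).comp χ).toIntLinearMap :=
    T.latticeBasis.ext fun i => by
      change T.extend χ (T.latticeBasis i : E) = χ (T.latticeBasis i)
      rw [coe_latticeBasis, extend_basis]
  exact LinearMap.congr_fun h ζ

theorem eq_extend {χ : expKer E G →+ ℤ} {l : E →ₗ[ℝ] ℝ} (h : ∀ ζ : expKer E G, l ζ = χ ζ) :
    l = T.extend χ :=
  T.basis.ext fun i => by rw [← coe_latticeBasis, h, extend_apply]

/-- The coordinate functionals on the lattice. -/
def latticeCoord (i : Fin T.k) : expKer E G →+ ℤ := (T.latticeBasis.coord i).toAddMonoidHom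

theorem extend_latticeCoord (i : Fin T.k) (ξ : E) :
    T.extend (T.latticeCoord i) ξ = T.basis.repr ξ i := by
  have : T.extend (T.latticeCoord i) = T.basis.coord i := T.basis.ext fun j => by
    rw [extend_basis]
    simp [latticeCoord, Finsupp.single_apply]
  rw [this]
  rfl

theorem eq_sum_latticeCoord (χ : expKer E G →+ ℤ) :
    χ = ∑ i, χ (T.latticeBasis i) • T.latticeCoord i := by
  ext ζ
  conv_lhs => rw [← T.latticeBasis.sum_repr ζ, map_sum]
  rw [AddMonoidHom.finsetSum_apply]
  refine Finset.sum_congr rfl fun i _ => ?_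
  rw [map_zsmul, AddMonoidHom.smul_apply, smul_eq_mul, smul_eq_mul, mul_comm]
  rfl

variable {A : Type} [AddCommGroup A] (e : A ≃+ (expKer E G →+ ℤ))

theorem sum_coord_smul (x : A) :
    ∑ i, e x (T.latticeBasis i) • e.symm (T.latticeCoord i) = x := by
  apply e.injective
  rw [map_sum]
  conv_rhs => rw [T.eq_sum_latticeCoord (e x)]
  exact Finset.sum_congr rfl fun i _ => by rw [map_zsmul, e.apply_symm_apply]

/-- The Lie algebra of a torus as the real dual of the group of its weights. -/
def lieEquiv : E ≃ₗ[ℝ] (A →+ ℝ) :=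
  LinearEquiv.ofBijective
    { toFun := fun ξ =>
        { toFun := fun x => T.extend (e x) ξ
          map_zero' := by simp
          map_add' := fun x y => by simp }
      map_add' := fun ξ ζ => AddMonoidHom.ext fun x => map_add (T.extend (e x)) ξ ζ
      map_smul' := fun r ξ => AddMonoidHom.ext fun x => map_smul (T.extend (e x)) r ξ }
    (by
      constructor
      · intro ξ ζ h
        refine T.basis.ext_elem fun i => ?_
        have : T.extend (e (e.symm (T.latticeCoord i))) ξ
            = T.extend (e (e.symm (T.latticeCoord i))) ζ :=
          DFunLike.congr_fun h (e.symm (T.latticeCoord i))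
        simpa [extend_latticeCoord] using this
      · intro f
        refine ⟨∑ i, f (e.symm (T.latticeCoord i)) • T.basis i, AddMonoidHom.ext fun x => ?_⟩
        change T.extend (e x) (∑ i, f (e.symm (T.latticeCoord i)) • T.basis i) = f x
        conv_rhs => rw [← T.sum_coord_smul e x]
        rw [map_sum, map_sum]
        refine Finset.sum_congr rfl fun i _ => ?_
        rw [map_smul, extend_basis, map_zsmul, smul_eq_mul, zsmul_eq_mul, mul_comm])

theorem lieEquiv_apply (ξ : E) (x : A) : T.lieEquiv e ξ x = T.extend (e x) ξ := rfl

variable [Module.Finite ℤ A]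

/-- The Lie algebra of a torus, identified with the model space of its group of characters of
weights. -/
def modelEquiv : E ≃L[ℝ] CharGroup.Model A :=
  have := T.finiteDimensional
  ((T.lieEquiv e).trans (CharGroup.coords A).symm).toContinuousLinearEquiv

/-- The exponential map of `Hom(A, 𝕋)` in terms of the Lie algebra of the torus. -/
def charExp : E →+ CharGroup A :=
  (CharGroup.exp A).comp (T.modelEquiv e).toLinearEquiv.toAddEquiv.toAddMonoidHom

theorem charExp_eq (ξ : E) : T.charExp e ξ = CharGroup.exp A (T.modelEquiv e ξ) := rfl

theorem charExp_apply (ξ : E) (x : A) :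
    T.charExp e ξ x = ((T.extend (e x) ξ : ℝ) : UnitAddCircle) := by
  rw [charExp_eq, CharGroup.exp_apply]
  have : CharGroup.coords A (T.modelEquiv e ξ) = T.lieEquiv e ξ :=
    (CharGroup.coords A).apply_symm_apply _
  rw [this, lieEquiv_apply]

/-- A character of `A` is determined by its values on the basis dual to the lattice basis, and real
lifts of these values are the coordinates of a preimage. -/
theorem charExp_surjective : Function.Surjective (T.charExp e) := by
  intro h
  choose t ht using fun i => QuotientAddGroup.mk_surjective (h (e.symm (T.latticeCoord i)))
  refine ⟨∑ i, t i • T.basis i, ?_⟩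
  refine DFunLike.ext _ _ fun x => ?_
  rw [charExp_apply, map_sum]
  have h1 : ∀ i, (((T.extend (e x)) (t i • T.basis i) : ℝ) : UnitAddCircle)
      = e x (T.latticeBasis i) • h (e.symm (T.latticeCoord i)) := by
    intro i
    rw [map_smul, extend_basis, smul_eq_mul, mul_comm, ← zsmul_eq_mul, ← ht]
    rfl
  have h2 : h x = ∑ i, e x (T.latticeBasis i) • h (e.symm (T.latticeCoord i)) := by
    conv_lhs => rw [← T.sum_coord_smul e x, map_sum]
    exact Finset.sum_congr rfl fun i _ => map_zsmul _ _ _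
  rw [h2, ← Finset.sum_congr rfl fun i _ => h1 i]
  exact map_sum (QuotientAddGroup.mk' (AddSubgroup.zmultiples (1 : ℝ))) _ _

/-- Both kernels are the integral lattice: the coordinate functionals detect integrality of each
coordinate, and integral functionals take integer values on the lattice. -/
theorem ker_charExp : (T.charExp e).ker = T.ex.ker := by
  ext ξ
  rw [AddMonoidHom.mem_ker, AddMonoidHom.mem_ker, T.ex_eq_zero_iff]
  constructor
  · intro h
    rw [Module.Basis.mem_span_iff_repr_mem ℤ T.basis ξ]
    intro i
    have h1 : T.charExp e ξ (e.symm (T.latticeCoord i)) = 0 := by rw [h]; rfl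
    rw [charExp_apply, e.apply_symm_apply, extend_latticeCoord, AddCircle.coe_eq_zero_iff] at h1
    obtain ⟨n, hn⟩ := h1
    exact ⟨n, by simpa using hn⟩
  · intro h
    refine DFunLike.ext _ _ fun x => ?_
    rw [charExp_apply, T.extend_apply (e x) ⟨ξ, T.mem_expKer.2 h⟩]
    exact (AddCircle.coe_eq_zero_iff (1 : ℝ)).2 ⟨e x ⟨ξ, T.mem_expKer.2 h⟩, by simp⟩

/-- The isomorphism `G ≅ Hom(A, 𝕋)`, `exp ξ ↦ (x ↦ ⟨x, ξ⟩ mod ℤ)`, for an identification of `A` with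
the weight lattice of the torus `G`. -/
def toCharGroup : G ≃+ CharGroup A :=
  ((QuotientAddGroup.quotientKerEquivOfSurjective T.ex T.surjective).symm.trans
    (QuotientAddGroup.quotientAddEquivOfEq (T.ker_charExp e).symm)).trans
      (QuotientAddGroup.quotientKerEquivOfSurjective (T.charExp e) (T.charExp_surjective e))

theorem toCharGroup_ex (ξ : E) : T.toCharGroup e (T.ex ξ) = T.charExp e ξ := by
  have h : (QuotientAddGroup.quotientKerEquivOfSurjective T.ex T.surjective).symm (T.ex ξ)
      = (ξ : E ⧸ T.ex.ker) :=
    (AddEquiv.symm_apply_eq _).2 rfl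
  simp only [toCharGroup, AddEquiv.trans_apply, h]
  rfl

theorem toCharGroup_apply {ξ : E} {g : G} (h : IsExp ξ g) {x : A} {l : E →ₗ[ℝ] ℝ}
    (hl : ∀ ζ : expKer E G, l ζ = e x ζ) : T.toCharGroup e g x = ((l ξ : ℝ) : UnitAddCircle) := by
  rw [T.isExp_iff] at h
  rw [← h, toCharGroup_ex, charExp_apply, T.eq_extend hl]

theorem isLocalDiffeomorph_exp :
    IsLocalDiffeomorph 𝓘(ℝ, CharGroup.Model A) 𝓘(ℝ, CharGroup.Model A) ∞ (CharGroup.exp A) :=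
  ToricStack.isLocalDiffeomorph_exp (CharGroup.exp_isLocalHomeomorph A)

/-- Smoothness is tested along the exponential map, where the isomorphism becomes a linear
identification of Lie algebras. The inverse is treated in the same way. -/
theorem contMDiff_toCharGroup :
    ContMDiff 𝓘(ℝ, E) 𝓘(ℝ, CharGroup.Model A) ∞ (T.toCharGroup e) := by
  refine contMDiff_of_comp_isLocalDiffeomorph T.isLocalDiffeomorph T.surjective ?_
  have : T.toCharGroup e ∘ T.ex = CharGroup.exp A ∘ T.modelEquiv e :=
    funext (T.toCharGroup_ex e)
  rw [this]
  exact isLocalDiffeomorph_exp.contMDiff.comp (T.modelEquiv e).contDiff.contMDiff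

theorem contMDiff_toCharGroup_symm :
    ContMDiff 𝓘(ℝ, CharGroup.Model A) 𝓘(ℝ, E) ∞ (T.toCharGroup e).symm := by
  have hs : Function.Surjective (CharGroup.exp A) :=
    Function.Surjective.of_comp (g := T.modelEquiv e) (T.charExp_surjective e)
  refine contMDiff_of_comp_isLocalDiffeomorph isLocalDiffeomorph_exp hs ?_
  have : (T.toCharGroup e).symm ∘ CharGroup.exp A = T.ex ∘ (T.modelEquiv e).symm := by
    funext v
    rw [Function.comp_apply, Function.comp_apply, AddEquiv.symm_apply_eq, toCharGroup_ex,
      charExp_eq, ContinuousLinearEquiv.apply_symm_apply]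
  rw [this]
  exact T.contMDiff.comp (T.modelEquiv e).symm.contDiff.contMDiff

/-- The linear extension of `ρ̇^∨(e^α)` from the lattice to the Lie algebra is `w^α`, which reduces
modulo `ℤ` to the coordinate of `ρ`. -/
theorem toCharGroup_weight {d : ℕ} (ρ : G →ₜ+ (Fin d → UnitAddCircle)) {α : Fin d} {x : A}
    (hx : e x = (coordZ α).comp (rhoDot ρ)) (g : G) : T.toCharGroup e g x = ρ g α := by
  obtain ⟨ξ, rfl⟩ := T.surjective g
  rw [toCharGroup_apply T e (T.isExp_iff.2 rfl) (l := (weight ρ α : E →L[ℝ] ℝ).toLinearMap),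
    ← T.coe_weight]
  · rfl
  · intro ζ
    rw [hx]
    exact (rhoDot_apply ρ ζ α).symm

end TorusExp

/-! ### Transport along an isomorphism of Lie groups -/

section Transport

variable {E : Type} [NormedAddCommGroup E] [NormedSpace ℝ E]
  {G : Type} [AddCommGroup G] [TopologicalSpace G] [ChartedSpace E G]
  {E' : Type} [NormedAddCommGroup E'] [NormedSpace ℝ E']
  {G' : Type} [AddCommGroup G'] [TopologicalSpace G'] [ChartedSpace E' G']
  {d : ℕ} {ρ : G →ₜ+ (Fin d → UnitAddCircle)} {ρ' : G' →ₜ+ (Fin d → UnitAddCircle)}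

/-- The differential at `0` of an isomorphism of Lie groups. -/
theorem exists_differential (Φ : G ≃+ G') (h1 : ContMDiff 𝓘(ℝ, E) 𝓘(ℝ, E') ∞ Φ)
    (h2 : ContMDiff 𝓘(ℝ, E') 𝓘(ℝ, E) ∞ Φ.symm) :
    ∃ D : E ≃L[ℝ] E', ∀ ξ : E, (mfderiv 𝓘(ℝ, E) 𝓘(ℝ, E') Φ 0 ξ : E') = D ξ := by
  let Ψ : Diffeomorph 𝓘(ℝ, E) 𝓘(ℝ, E') G G' ∞ := ⟨Φ.toEquiv, h1, h2⟩
  exact ⟨Ψ.mfderivToContinuousLinearEquiv (by simp) 0, fun ξ => rfl⟩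

/-- The chain rule for characters matched by `Φ`. Smoothness of the character of `G'` comes from
that on the torus `G` by composing with `Φ⁻¹`. -/
theorem weight_mfderiv (T : TorusExp E G) (Φ : G ≃+ G')
    (h1 : ContMDiff 𝓘(ℝ, E) 𝓘(ℝ, E') ∞ Φ) (h2 : ContMDiff 𝓘(ℝ, E') 𝓘(ℝ, E) ∞ Φ.symm)
    (hρ : ∀ g, ρ' (Φ g) = ρ g) (α : Fin d) (ξ : E) :
    (weight ρ' α : E' →L[ℝ] ℝ) (mfderiv 𝓘(ℝ, E) 𝓘(ℝ, E') Φ 0 ξ) = weight ρ α ξ := by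
  have hchar : charFun ρ' α ∘ Φ = charFun ρ α := funext fun g => by simp [charFun, hρ]
  have hchar' : charFun ρ' α = charFun ρ α ∘ Φ.symm := by
    rw [← hchar, Function.comp_assoc]
    simp
  have hsm : ContMDiff 𝓘(ℝ, E') 𝓘(ℝ, ℂ) ∞ (charFun ρ' α) := by
    rw [hchar']
    exact (T.contMDiff_charFun ρ α).comp h2
  have h3 := mfderiv_comp_apply (I := 𝓘(ℝ, E)) (I' := 𝓘(ℝ, E')) (I'' := 𝓘(ℝ, ℂ)) (0 : G)
    (hsm.mdifferentiableAt (x := Φ 0) (by simp)) (h1.mdifferentiableAt (by simp)) ξ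
  rw [hchar] at h3
  have h4 : ∀ x : G', x = 0 → ∀ ζ : E',
      (mfderiv 𝓘(ℝ, E') 𝓘(ℝ, ℂ) (charFun ρ' α) x ζ : ℂ) = dChar ρ' α ζ := by
    rintro _ rfl ζ; rfl
  have h5 : dChar ρ α ξ = (dChar ρ' α : E' →L[ℝ] ℂ) (mfderiv 𝓘(ℝ, E) 𝓘(ℝ, E') Φ 0 ξ) :=
    h3.trans (h4 _ (map_zero Φ) _)
  exact congrArg (fun w : ℂ => (2 * Real.pi)⁻¹ * w.im) h5.symm

variable {τ : E →L[ℝ] ℝ} {τ' : E' →L[ℝ] ℝ} {D : E ≃L[ℝ] E'}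

theorem momentMap_comp (hD : ∀ α ξ, weight ρ' α (D ξ) = weight ρ α ξ) (z : Fin d → ℂ) (ξ : E) :
    (momentMap ρ' z : E' →L[ℝ] ℝ) (D ξ) = (momentMap ρ z : E →L[ℝ] ℝ) ξ := by
  simp only [momentMap_apply, hD]

theorem levelSet_eq (hD : ∀ α ξ, weight ρ' α (D ξ) = weight ρ α ξ) (hτ : ∀ ξ, τ' (D ξ) = τ ξ) :
    levelSet ρ' τ' = levelSet ρ τ := by
  ext z
  change momentMap ρ' z = τ' ↔ momentMap ρ z = τ
  constructor
  · intro h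
    ext ξ
    rw [← momentMap_comp hD, h, hτ]
  · intro h
    ext ζ
    obtain ⟨ξ, rfl⟩ := D.surjective ζ
    rw [momentMap_comp hD, h, hτ]

/-- The two moment maps differ by the linear isomorphism of dual Lie algebras induced by `D`, which
preserves surjectivity of derivatives and properness. -/
theorem QuotientHyp.transport (h : QuotientHyp ρ τ)
    (hD : ∀ α ξ, weight ρ' α (D ξ) = weight ρ α ξ) (hτ : ∀ ξ, τ' (D ξ) = τ ξ) :
    QuotientHyp ρ' τ' := by
  let Dt : (E →L[ℝ] ℝ) ≃L[ℝ] (E' →L[ℝ] ℝ) := D.arrowCongr (ContinuousLinearEquiv.refl ℝ ℝ)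
  have hDt : (momentMap ρ' : (Fin d → ℂ) → (E' →L[ℝ] ℝ)) = Dt ∘ momentMap ρ := by
    funext z
    ext ζ
    obtain ⟨ξ, rfl⟩ := D.surjective ζ
    rw [momentMap_comp hD]
    simp [Dt]
  refine ⟨fun z hz => ?_, ?_, ?_⟩
  · rw [levelSet_eq hD hτ] at hz
    rw [hDt, Dt.comp_fderiv]
    exact Dt.surjective.comp (h.regular z hz)
  · rw [levelSet_eq hD hτ]
    exact h.nonempty
  · rw [hDt]
    exact Dt.toHomeomorph.isProperMap.comp h.proper

end Transport

/-! ### Change of structure group along an isomorphism -/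

section ChangeOfGroup

variable {E : Type} [NormedAddCommGroup E] [NormedSpace ℝ E]
  {G : Type} [AddCommGroup G] [TopologicalSpace G] [ChartedSpace E G]
  {E' : Type} [NormedAddCommGroup E'] [NormedSpace ℝ E']
  {G' : Type} [AddCommGroup G'] [TopologicalSpace G'] [ChartedSpace E' G']

/-- A principal `G'`-bundle as a principal `G`-bundle, for an isomorphism `Φ : G ≅ G'`. -/
def PrincipalBundle.changeGroup (Φ : G ≃+ G') (h1 : ContMDiff 𝓘(ℝ, E) 𝓘(ℝ, E') ∞ Φ)
    (h2 : ContMDiff 𝓘(ℝ, E') 𝓘(ℝ, E) ∞ Φ.symm) {U : Mfd} (P : PrincipalBundle E' G' U) :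
    PrincipalBundle E G U where
  total := P.total
  proj := P.proj
  act p g := P.act p (Φ g)
  act_smooth := P.act_smooth.comp (contMDiff_fst.prodMk (h1.comp contMDiff_snd))
  act_zero p := by rw [map_zero, P.act_zero]
  act_add p g h := by rw [map_add, P.act_add]
  proj_act p g := P.proj_act p (Φ g)
  locally_trivial u := by
    obtain ⟨V, hV, hu, φ, hs, ht, hφ, hφ', hfst, hact⟩ := P.locally_trivial u
    -- The old trivialization followed by `Φ⁻¹` on the fibre is equivariant for the relabelled
    -- action.
    let Ψ : G' ≃ₜ G := ⟨Φ.symm.toEquiv, h2.continuous, h1.continuous⟩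
    let φ' := φ.transHomeomorph ((Homeomorph.refl U).prodCongr Ψ)
    have hφ1 : ∀ p, φ' p = ((φ p).1, Φ.symm (φ p).2) := fun p => rfl
    have hφ2 : ∀ q, φ'.symm q = φ.symm (q.1, Φ q.2) := fun q => rfl
    have hpre : ∀ q : U × G, q ∈ φ'.target ↔ (q.1, Φ q.2) ∈ φ.target := fun q => Iff.rfl
    refine ⟨V, hV, hu, φ', hs, ?_, ?_, ?_, hfst, ?_⟩
    · ext q
      rw [hpre, ht]
      simp
    · have h3 : ContMDiff ((𝓡 U.dim).prod 𝓘(ℝ, E')) ((𝓡 U.dim).prod 𝓘(ℝ, E)) ∞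
          (fun q : U × G' => (q.1, Φ.symm q.2)) :=
        contMDiff_fst.prodMk (h2.comp contMDiff_snd)
      exact h3.comp_contMDiffOn hφ
    · have h3 : ContMDiff ((𝓡 U.dim).prod 𝓘(ℝ, E)) ((𝓡 U.dim).prod 𝓘(ℝ, E')) ∞
          (fun q : U × G => (q.1, Φ q.2)) :=
        contMDiff_fst.prodMk (h1.comp contMDiff_snd)
      exact hφ'.comp h3.contMDiffOn fun q hq => hq
    · intro p hp g
      rw [hφ1, hφ1, hact p hp]
      simp

variable {d : ℕ} {ρ : G →ₜ+ (Fin d → UnitAddCircle)} {τ : E →L[ℝ] ℝ}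
  {ρ' : G' →ₜ+ (Fin d → UnitAddCircle)} {τ' : E' →L[ℝ] ℝ}

variable (ρ τ ρ' τ') in
/-- An isomorphism of Lie groups that identifies the data of two symplectic quotients. -/
structure QuotientIso where
  Φ : G ≃+ G'
  contMDiff : ContMDiff 𝓘(ℝ, E) 𝓘(ℝ, E') ∞ Φ
  contMDiff_symm : ContMDiff 𝓘(ℝ, E') 𝓘(ℝ, E) ∞ Φ.symm
  map_rho : ∀ g, ρ' (Φ g) = ρ g
  levelSet_eq : levelSet ρ' τ' = levelSet ρ τ

namespace QuotientIso

/-- The inverse isomorphism. -/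
def symm (I : QuotientIso ρ τ ρ' τ') : QuotientIso ρ' τ' ρ τ where
  Φ := I.Φ.symm
  contMDiff := I.contMDiff_symm
  contMDiff_symm := I.contMDiff
  map_rho g := by rw [← I.map_rho, AddEquiv.apply_symm_apply]
  levelSet_eq := I.levelSet_eq.symm

variable (I : QuotientIso ρ τ ρ' τ')

/-- Change of structure group on objects. -/
def mapObj (x : QuotObj ρ' τ') : QuotObj ρ τ where
  base := x.base
  bundle := x.bundle.changeGroup I.Φ I.contMDiff I.contMDiff_symm
  ε := x.ε
  ε_smooth := x.ε_smooth
  ε_mem p := I.levelSet_eq ▸ x.ε_mem p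
  ε_act p g := by
    refine (x.ε_act p (I.Φ g)).trans ?_
    rw [← map_neg, I.map_rho]

/-- Change of structure group on morphisms. -/
def mapHom {x y : QuotObj ρ' τ'} (f : QuotHom x y) : QuotHom (I.mapObj x) (I.mapObj y) where
  onBase := f.onBase
  onTotal := f.onTotal
  comm := f.comm
  equivariant p g := f.equivariant p (I.Φ g)
  ε_comm := f.ε_comm

/-- Change of structure group, as a morphism of categories over the category of manifolds. -/
def functor : BasedFunctor (symplecticQuotient ρ' τ') (symplecticQuotient ρ τ) where
  obj := fun x => I.mapObj (toObj x)
  map := fun f => I.mapHom (toHom f)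
  map_id := fun _ => rfl
  map_comp := fun _ _ => rfl
  w := rfl

/-- Changing the structure group back and forth does nothing. -/
def unitIso (x : QuotObj ρ' τ') : x ≅ I.symm.mapObj (I.mapObj x) where
  hom :=
    { onBase := 𝟙 x.base
      onTotal := 𝟙 x.bundle.total
      comm := (Category.id_comp x.bundle.proj).trans (Category.comp_id x.bundle.proj).symm
      equivariant := fun p g => congrArg (x.bundle.act p) (I.Φ.apply_symm_apply g).symm
      ε_comm := fun _ => rfl }
  inv :=
    { onBase := 𝟙 x.base
      onTotal := 𝟙 x.bundle.total
      comm := (Category.id_comp x.bundle.proj).trans (Category.comp_id x.bundle.proj).symm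
      equivariant := fun p g => congrArg (x.bundle.act p) (I.Φ.apply_symm_apply g)
      ε_comm := fun _ => rfl }
  hom_inv_id := QuotHom.ext (Category.id_comp _) (Category.id_comp _)
  inv_hom_id := QuotHom.ext (Category.id_comp _) (Category.id_comp _)

/-- The unit of the equivalence given by change of structure group. -/
def unit : BasedFunctor.id (symplecticQuotient ρ' τ') ≅ I.functor.comp I.symm.functor :=
  BasedNatIso.mkNatIso
    (NatIso.ofComponents (fun x => I.unitIso (toObj x)) fun {x y} f => QuotHom.ext
      ((Category.comp_id (toHom f).onBase).trans (Category.id_comp _).symm)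
      ((Category.comp_id (toHom f).onTotal).trans (Category.id_comp _).symm))
    fun x => by
      have := IsHomLift.map (symplecticQuotient ρ' τ').p (I.unitIso (toObj x)).hom
      exact this

/-- Change of structure group along an isomorphism is an equivalence of stacks. -/
def equivalence :
    Bicategory.Equivalence (symplecticQuotient ρ' τ') (symplecticQuotient ρ τ) where
  hom := I.functor
  inv := I.symm.functor
  unit := I.unit
  counit := I.symm.unit.symm
  left_triangle := by
    -- Unit and counit are identities on bases and total spaces, so the triangle identity is checked
    -- there and holds definitionally.
    refine Iso.ext (BasedNatTrans.ext _ _ (NatTrans.ext (funext fun x => QuotHom.ext ?_ ?_)))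
    · rfl
    · rfl

theorem isChangeOfGroup : IsChangeOfGroup I.Φ I.functor :=
  ⟨fun _ => Iso.refl _, fun x =>
    (Category.id_comp _).trans (Category.comp_id (toObj x).bundle.proj), fun _ _ => rfl,
    fun _ _ _ => rfl, fun f =>
      (Category.comp_id (toHom f).onTotal).trans (Category.id_comp (toHom f).onTotal).symm⟩

end QuotientIso

end ChangeOfGroup

/-! ### The stack of the stacky polytope of a symplectic quotient -/

/-- A symplectic quotient by a torus is the stack built from a cokernel of the map of lattices. -/
theorem exists_equivalence_stackyPolytopeStack
    {E : Type} [NormedAddCommGroup E] [NormedSpace ℝ E]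
    {G : Type} [AddCommGroup G] [TopologicalSpace G] [ChartedSpace E G]
    [LieAddGroup 𝓘(ℝ, E) ∞ G] (T : TorusExp E G) {d : ℕ} {ρ : G →ₜ+ (Fin d → UnitAddCircle)}
    {τ : E →L[ℝ] ℝ} (h : QuotientHyp ρ τ) {c : Fin d → ℝ} (hc : ∑ α, c α • weight ρ α = τ)
    {N : Type} [AddCommGroup N] {β : (Fin d → ℤ) →+ N} (hβ : Function.Surjective β)
    (hker : β.ker = (rhoDot (E := E) ρ).range)
    {P : FreeResolution (Fin d → ℤ)} {Q : FreeResolution N} (b : ChainLift β P Q) :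
    ∃ (e : b.DG ≃+ (expKer E G →+ ℤ)) (Φ : G ≃+ CharGroup b.DG),
      (∀ φ : (Fin d → ℤ) →+ ℤ, e (b.toDG φ) = φ.comp (rhoDot ρ)) ∧
      (∀ (ξ : E) (g : G), IsExp ξ g → ∀ (x : b.DG) (l : E →ₗ[ℝ] ℝ),
        (∀ ζ : expKer E G, l ζ = e x ζ) → Φ g x = ((l ξ : ℝ) : UnitAddCircle)) ∧
      ContMDiff 𝓘(ℝ, E) 𝓘(ℝ, CharGroup.Model b.DG) ∞ Φ ∧
      ContMDiff 𝓘(ℝ, CharGroup.Model b.DG) 𝓘(ℝ, E) ∞ Φ.symm ∧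
      (∀ g, rhoDG b (Φ g) = ρ g) ∧
      (∀ ξ : E, tauDG b c (mfderiv 𝓘(ℝ, E) 𝓘(ℝ, CharGroup.Model b.DG) Φ 0 ξ) = τ ξ) ∧
      QuotientHyp (rhoDG b) (tauDG b c) ∧
      ∃ 𝓔 : Bicategory.Equivalence (stackyPolytopeStack b c) (symplecticQuotient ρ τ),
        IsChangeOfGroup Φ 𝓔.hom := by
  have hfree : Module.Free ℤ (expKer E G) := Module.Free.of_basis T.latticeBasis
  obtain ⟨e, he⟩ := b.exists_DG_equiv hβ (rhoDot_injective h) hker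
  have hρ : ∀ g, rhoDG b (T.toCharGroup e g) = ρ g := fun g =>
    funext fun α => T.toCharGroup_weight e ρ (he (coordZ α)) g
  have h1 := T.contMDiff_toCharGroup e
  have h2 := T.contMDiff_toCharGroup_symm e
  obtain ⟨D, hD⟩ := exists_differential (T.toCharGroup e) h1 h2
  have hw : ∀ α ξ, weight (rhoDG b) α (D ξ) = weight ρ α ξ := fun α ξ => by
    rw [← hD]
    exact weight_mfderiv T (T.toCharGroup e) h1 h2 hρ α ξ
  have hτ : ∀ ξ, tauDG b c (D ξ) = τ ξ := fun ξ => by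
    rw [← hc]
    simp [tauDG, hw]
  let I : QuotientIso ρ τ (rhoDG b) (tauDG b c) := ⟨T.toCharGroup e, h1, h2, hρ, levelSet_eq hw hτ⟩
  exact ⟨e, T.toCharGroup e, he, fun ξ g hg x l hl => T.toCharGroup_apply e hg hl, h1, h2, hρ,
    fun ξ => (congrArg (tauDG b c) (hD ξ)).trans (hτ ξ), h.transport hw hτ, I.equivalence,
    I.isChangeOfGroup⟩

end

end ToricStack

/-! ### The main theorem, for the cokernel of `ρ̇` -/

open ToricStack

theorem mainTheorem4
    {E : Type} [NormedAddCommGroup E] [NormedSpace ℝ E]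
    {G : Type} [AddCommGroup G] [TopologicalSpace G] [ChartedSpace E G]
    [LieAddGroup 𝓘(ℝ, E) ∞ G] (hG : IsTorus E G)
    {d : ℕ} (ρ : G →ₜ+ (Fin d → UnitAddCircle)) (τ : E →L[ℝ] ℝ) (h : QuotientHyp ρ τ)
    (c : Fin d → ℝ) (hc : ∑ α, c α • weight ρ α = τ) :
    let N : Type := (Fin d → ℤ) ⧸ (rhoDot (E := E) ρ).range
    let β : (Fin d → ℤ) →+ N := QuotientAddGroup.mk' (rhoDot (E := E) ρ).range
    let Δ : Set (TDual N) := {η | ∀ α, -c α ≤ η (nbar β α)}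
    let F : Fin d → Set (TDual N) := fun α => {η ∈ Δ | η (nbar β α) = -c α}
    (∃ s, IsTorusSection β s) ∧
    (∀ s, IsTorusSection β s → reducedMomentMap c s '' levelSet ρ τ = Δ) ∧
    IsStackyPolytope β Δ F ∧
    IsSupport β Δ F c ∧
    ∀ (P : FreeResolution (Fin d → ℤ)) (Q : FreeResolution N) (b : ChainLift β P Q),
      ∃ (e : b.DG ≃+ (expKer E G →+ ℤ)) (Φ : G ≃+ CharGroup b.DG),
        (∀ φ : (Fin d → ℤ) →+ ℤ, e (b.toDG φ) = φ.comp (rhoDot ρ)) ∧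
        (∀ (ξ : E) (g : G), IsExp ξ g → ∀ (x : b.DG) (l : E →ₗ[ℝ] ℝ),
          (∀ ζ : expKer E G, l ζ = e x ζ) → Φ g x = ((l ξ : ℝ) : UnitAddCircle)) ∧
        ContMDiff 𝓘(ℝ, E) 𝓘(ℝ, CharGroup.Model b.DG) ∞ Φ ∧
        ContMDiff 𝓘(ℝ, CharGroup.Model b.DG) 𝓘(ℝ, E) ∞ Φ.symm ∧
        (∀ g, rhoDG b (Φ g) = ρ g) ∧
        (∀ ξ : E, tauDG b c (mfderiv 𝓘(ℝ, E) 𝓘(ℝ, CharGroup.Model b.DG) Φ 0 ξ) = τ ξ) ∧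
        QuotientHyp (rhoDG b) (tauDG b c) ∧
        ∃ 𝓔 : Bicategory.Equivalence (stackyPolytopeStack b c) (symplecticQuotient ρ τ),
          IsChangeOfGroup Φ 𝓔.hom := by
  intro N β Δ F
  obtain ⟨T⟩ := hG.nonempty_torusExp
  have hβ : Function.Surjective β := QuotientAddGroup.mk'_surjective _
  have hker : β.ker = (rhoDot (E := E) ρ).range := QuotientAddGroup.ker_mk' _
  exact ⟨exists_isTorusSection hβ, fun s hs => image_reducedMomentMap T hβ hker hc hs,
    isStackyPolytope_of_quotientHyp T hβ hker hc h, ⟨rfl, fun _ => rfl⟩,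
    fun P Q b => exists_equivalence_stackyPolytopeStack T h hc hβ hker b⟩
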